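/- Let $c,\omega,\delta\in\mathbb R$, $\gamma\in(\tfrac13,\tfrac12)$, $2\omega\notin\pi\mathbb Z$, let $\{q_n\}_{n\ge1}$ be a real sequence in $l^1$, and let $$b_n=\frac{c\sin(2\omega n+\delta)}{n^{\gamma}}+q_n,\qquad n\ge1.$$ Let $P_n$ be the orthonormal polynomials associated to the Jacobi matrix with diagonal entries $b_1,b_2,\dots$ and off-diagonal entries $1$, that is, $P_1(\lambda)=1$, $P_2(\lambda)=\lambda-b_1$ and $P_{n+1}(\lambda)=(\lambda-b_n)P_n(\lambda)-P_{n-1}(\lambda)$ for $n\ge2$. Let $\mathbb D$ be the open unit disc, $\mathbb T$ the unit circle, $$U=\mathbb C\setminus\{0,1,-1,e^{\pm i\omega},-e^{\pm i\omega},e^{\pm2i\omega},-e^{\pm2i\omega}\},\qquad \mu_2(z)=\frac{c^2z^2(1+z^2)e^{2i\omega}}{4(1-z^2)(z^2-e^{2i\omega})(1-z^2e^{2i\omega})}.$$ Then there is a function $F:\overline{\mathbb D}\cap U\to\mathbb C$ (the Jost function) with the following properties. - For every $z\in\mathbb D\setminus\{0\}$, as $n\to\infty$, $$P_n\left(z+\frac1z\right)=\frac{zF(z)}{1-z^2}\,\frac1{z^n}\exp\left(\frac{\mu_2(z)n^{1-2\gamma}}{1-2\gamma}\right)+o\left(\frac1{|z|^n}\exp\left(\frac{\operatorname{Re}\mu_2(z)\,n^{1-2\gamma}}{1-2\gamma}\right)\right).$$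 - For every $z\in\mathbb T\cap U$, as $n\to\infty$, $$P_n\left(z+\frac1z\right)=\frac{zF(z)}{1-z^2}\,\frac1{z^n}\exp\left(\frac{\mu_2(z)n^{1-2\gamma}}{1-2\gamma}\right)+\frac{z\overline{F(z)}}{z^2-1}\,z^n\exp\left(-\frac{\mu_2(z)n^{1-2\gamma}}{1-2\gamma}\right)+o(1).$$ - $F$ is analytic in $\mathbb D\setminus\{0\}$ and continuous on $\overline{\mathbb D}\cap U$ (in particular, on $\mathbb T\cap U$). -/

import Mathlib

open Filter Asymptotics Topology

/-- The orthonormal polynomials `P n` associated with the Jacobi matrix with off-diagonal entries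
`1` and diagonal entries `b 1, b 2, …`: `P 1 = 1`, `P 2 = X - b 1` and
`P (n + 1) = (X - b n) * P n - P (n - 1)` for `n ≥ 2`. The value `P 0 = 0` makes the recurrence
hold for `n = 1` as well; the sequence is indexed from `1`, and `b 0` is not used. -/
noncomputable def orthoPoly (b : ℕ → ℝ) : ℕ → Polynomial ℝ
  | 0 => 0
  | 1 => 1
  | n + 2 => (Polynomial.X - Polynomial.C (b (n + 1))) * orthoPoly b (n + 1) - orthoPoly b n

/-- The value `P n (lam)` at a complex point. -/
noncomputable def orthoPolyEval (b : ℕ → ℝ) (n : ℕ) (lam : ℂ) : ℂ :=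
  Polynomial.aeval lam (orthoPoly b n)

/-- The set `U`: the complex plane without
`0, 1, -1, e^{±iω}, -e^{±iω}, e^{±2iω}, -e^{±2iω}`. -/
def regularSet (ω : ℝ) : Set ℂ :=
  {0, 1, -1,
    Complex.exp (Complex.I * ω), Complex.exp (-(Complex.I * ω)),
    -Complex.exp (Complex.I * ω), -Complex.exp (-(Complex.I * ω)),
    Complex.exp (2 * Complex.I * ω), Complex.exp (-(2 * Complex.I * ω)),
    -Complex.exp (2 * Complex.I * ω), -Complex.exp (-(2 * Complex.I * ω))}ᶜ

/-- `μ₂(z) = c² z² (1 + z²) e^{2iω} / (4 (1 - z²) (z² - e^{2iω}) (1 - z² e^{2iω}))`. -/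
noncomputable def mu2 (c ω : ℝ) (z : ℂ) : ℂ :=
  (c : ℂ) ^ 2 * z ^ 2 * (1 + z ^ 2) * Complex.exp (2 * Complex.I * ω) /
    (4 * (1 - z ^ 2) * (z ^ 2 - Complex.exp (2 * Complex.I * ω)) *
      (1 - z ^ 2 * Complex.exp (2 * Complex.I * ω)))

/-- The exponent `μ₂(z) n^{1-2γ} / (1 - 2γ)`. -/
noncomputable def phaseExponent (c ω γ : ℝ) (z : ℂ) (n : ℕ) : ℂ :=
  mu2 c ω z * (((n : ℝ) ^ (1 - 2 * γ) : ℝ) : ℂ) / (1 - 2 * (γ : ℂ))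

/-! Put `t = n^{-γ}`, `θ_n = z^n exp(-μ₂(z) n^{1-2γ}/(1-2γ))` and look for a decaying solution `ψ_n
= θ_n (1 + t·(first harmonics) + t²·(second harmonics))` of the recurrence. The coefficients of the
harmonics `e^{±2iωn}` and `e^{±4iωn}` are found by dividing by differences of the free symbol `z +
1/z`, which do not vanish on `U`. At order `t²` the product of the two opposite first harmonics
leaves a non-oscillating term that no correction can absorb; the slowly varying phase cancels it,
and this forces the value of `μ₂` (`mu2_mul_eq`). What remains is of size `t³`, `|q|` and
differences of `t`, which is summable because `γ > 1/3` (`isBigO_jostResidual`).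

Since `μ₂(1/z) = -μ₂(z)`, the sequence `ψ_n(1/z)` is a second approximate solution, growing like
`1/θ_n`. A discrete Gronwall argument with this pair (`solution_bound_of_approx`) shows that `P_n
θ_n` is bounded, locally uniformly up to the regular part of the circle. The Wronskian `W_n =
P_{n+1} ψ_n - P_n ψ_{n+1}` changes only by `P_{n+1}` times the residual of `ψ`, so it converges
locally uniformly; its limit is `F`, which gives analyticity and continuity.

Convergence of `W_n` is a first order relation for `P_n`. In the disc it reads `p_{n+1} - z² p_n →
zF` for `p_n = P_n θ_n`, a contraction because `|z| < 1`. On the circle `P_n` is real, so the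
relation and its complex conjugate are two linear equations from which `P_n` is obtained by
elimination. -/

/-- The decay rate `n ^ (-γ)`. -/
noncomputable def decay (γ : ℝ) (n : ℕ) : ℝ := (n : ℝ) ^ (-γ)

/-- The increment of `n ^ (1 - 2γ) / (1 - 2γ)`. -/
noncomputable def phaseStep (γ : ℝ) (n : ℕ) : ℝ :=
  (((n + 1 : ℕ) : ℝ) ^ (1 - 2 * γ) - (n : ℝ) ^ (1 - 2 * γ)) / (1 - 2 * γ)

/-! ### Elementary estimates for `n^{-γ}` and the phase increments. -/

section Decay

variable {γ : ℝ}

lemma decay_nonneg (n : ℕ) : 0 ≤ decay γ n := Real.rpow_nonneg (Nat.cast_nonneg n) _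

lemma decay_le_one (hγ : 0 < γ) (n : ℕ) : decay γ n ≤ 1 := by
  rcases Nat.eq_zero_or_pos n with rfl | hn
  · simp [decay, Real.zero_rpow (neg_ne_zero.mpr hγ.ne')]
  · exact Real.rpow_le_one_of_one_le_of_nonpos (by exact_mod_cast hn) (by linarith)

lemma decay_succ_le (hγ : 0 < γ) {n : ℕ} (hn : 1 ≤ n) : decay γ (n + 1) ≤ decay γ n :=
  Real.rpow_le_rpow_of_nonpos (by exact_mod_cast hn) (by push_cast; linarith) (by linarith)

lemma decay_sq {n : ℕ} : decay γ n ^ 2 = (n : ℝ) ^ (-(2 * γ)) := by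
  rw [decay, ← Real.rpow_natCast, ← Real.rpow_mul (Nat.cast_nonneg n)]
  congr 1; push_cast; ring

lemma tendsto_decay (hγ : 0 < γ) : Tendsto (decay γ) atTop (𝓝 0) :=
  (tendsto_rpow_neg_atTop hγ).comp tendsto_natCast_atTop_atTop

/-- The threshold `1/3` comes from here: third order terms may be discarded exactly when `3γ > 1`.
-/
lemma summable_decay_cube (hγ : 1 / 3 < γ) : Summable fun n => decay γ n ^ 3 := by
  have : (fun n => decay γ n ^ 3) = fun n : ℕ => (n : ℝ) ^ (-(3 * γ)) := by
    funext n
    rw [decay, ← Real.rpow_natCast, ← Real.rpow_mul (Nat.cast_nonneg n)]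
    congr 1; push_cast; ring
  rw [this, Real.summable_nat_rpow]
  linarith

lemma summable_decay_sub (hγ : 0 < γ) : Summable fun n => decay γ n - decay γ (n + 1) := by
  -- The term at `0` is dropped because `0 ^ (-γ) = 0` in Lean, so monotonicity starts at `1`; the
  -- rest telescopes.
  rw [← summable_nat_add_iff 1]
  refine summable_of_sum_range_le (c := 1) (fun n => ?_) fun n => ?_
  · exact sub_nonneg.mpr (decay_succ_le hγ (by omega))
  · rw [Finset.sum_range_sub' (fun n => decay γ (n + 1))]
    linarith [decay_le_one hγ (0 + 1), decay_nonneg (γ := γ) (n + 1)]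

/-- Mean value theorem: `x^{1-2γ}/(1-2γ)` has the decreasing derivative `x^{-2γ}`. -/
lemma phaseStep_mem_Icc (hγ : 0 < γ) (hγ' : γ < 1 / 2) {n : ℕ} (hn : 1 ≤ n) :
    phaseStep γ n ∈ Set.Icc (decay γ (n + 1) ^ 2) (decay γ n ^ 2) := by
  have hn0 : (0 : ℝ) < n := by exact_mod_cast hn
  have hs : (1 - 2 * γ) ≠ 0 := by linarith
  obtain ⟨x, hx, hx'⟩ := exists_hasDerivAt_eq_slope
    (fun x : ℝ => x ^ (1 - 2 * γ) / (1 - 2 * γ)) (fun x : ℝ => x ^ (-(2 * γ)))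
    (a := n) (b := (n + 1 : ℕ)) (by push_cast; linarith)
    (fun x hx => ContinuousAt.continuousWithinAt
      ((Real.continuousAt_rpow_const _ _ (Or.inl (hn0.trans_le hx.1).ne')).div_const _))
    (fun x hx => by
      have h := (Real.hasDerivAt_rpow_const (p := 1 - 2 * γ)
        (Or.inl (hn0.trans hx.1).ne')).div_const (1 - 2 * γ)
      rwa [mul_div_cancel_left₀ _ hs, show 1 - 2 * γ - 1 = -(2 * γ) by ring] at h)
  have : phaseStep γ n = x ^ (-(2 * γ)) := by
    rw [hx', phaseStep]; push_cast; ring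
  rw [this, decay_sq, decay_sq]
  exact ⟨Real.rpow_le_rpow_of_nonpos (hn0.trans hx.1) hx.2.le (by linarith),
    Real.rpow_le_rpow_of_nonpos hn0 hx.1.le (by linarith)⟩

lemma tendsto_phaseStep (hγ : 0 < γ) (hγ' : γ < 1 / 2) :
    Tendsto (phaseStep γ) atTop (𝓝 0) := by
  have h := (tendsto_decay hγ).pow 2
  rw [zero_pow two_ne_zero] at h
  refine tendsto_of_tendsto_of_tendsto_of_le_of_le' (h.comp (tendsto_add_atTop_nat 1)) h ?_ ?_ <;>
  filter_upwards [eventually_ge_atTop 1] with n hn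
  exacts [(phaseStep_mem_Icc hγ hγ' hn).1, (phaseStep_mem_Icc hγ hγ' hn).2]

end Decay

/-! ### The set `U` in terms of `z²`, and its symmetry under inversion. -/

section RegularSet

variable {ω : ℝ} {z : ℂ}

lemma isOpen_regularSet (ω : ℝ) : IsOpen (regularSet ω) :=
  (Set.Finite.isClosed (by simp)).isOpen_compl

lemma sq_eq_exp_two_mul_iff {w : ℂ} : z ^ 2 = Complex.exp (2 * w) ↔
    z = Complex.exp w ∨ z = -Complex.exp w := by
  rw [two_mul, Complex.exp_add, ← sq, sq_eq_sq_iff_eq_or_eq_neg]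

lemma mem_regularSet_iff : z ∈ regularSet ω ↔ z ≠ 0 ∧ z ^ 2 ≠ 1 ∧
    z ^ 2 ≠ Complex.exp (2 * Complex.I * ω) ∧ z ^ 2 ≠ (Complex.exp (2 * Complex.I * ω))⁻¹ ∧
    z ^ 2 ≠ Complex.exp (2 * Complex.I * ω) ^ 2 ∧
    z ^ 2 ≠ (Complex.exp (2 * Complex.I * ω))⁻¹ ^ 2 := by
  have h1 : Complex.exp (2 * Complex.I * ω) = Complex.exp (2 * (Complex.I * ω)) := by ring_nf
  have h2 : (Complex.exp (2 * Complex.I * ω))⁻¹ = Complex.exp (2 * -(Complex.I * ω)) := by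
    rw [← Complex.exp_neg]; ring_nf
  have h3 : Complex.exp (2 * Complex.I * ω) ^ 2 = Complex.exp (2 * (2 * Complex.I * ω)) := by
    rw [← Complex.exp_nat_mul]; norm_num
  have h4 : (Complex.exp (2 * Complex.I * ω))⁻¹ ^ 2 =
      Complex.exp (2 * -(2 * Complex.I * ω)) := by
    rw [← Complex.exp_neg, ← Complex.exp_nat_mul]; norm_num
  have h5 : z ^ 2 = 1 ↔ z = 1 ∨ z = -1 := by rw [← one_pow 2, sq_eq_sq_iff_eq_or_eq_neg]; simp
  rw [h4, h3, h2]
  simp only [h5, ne_eq, h1, sq_eq_exp_two_mul_iff, regularSet, Set.mem_compl_iff,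
    Set.mem_insert_iff, Set.mem_singleton_iff]
  have h6 : Complex.exp (2 * -(Complex.I * ω)) = Complex.exp (-(2 * (Complex.I * ω))) := by
    ring_nf
  tauto

lemma inv_mem_regularSet (hz : z ∈ regularSet ω) : z⁻¹ ∈ regularSet ω := by
  rw [mem_regularSet_iff] at hz ⊢
  simp only [ne_eq, inv_pow, inv_eq_iff_eq_inv, inv_inv, inv_zero, inv_one] at hz ⊢
  tauto

lemma mem_regularSet_of_norm_lt_one (h0 : z ≠ 0) (hz : ‖z‖ < 1) : z ∈ regularSet ω := by
  have h : ‖Complex.exp (2 * Complex.I * ω)‖ = 1 := by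
    rw [show 2 * Complex.I * (ω : ℂ) = ((2 * ω : ℝ) : ℂ) * Complex.I by push_cast; ring]
    exact Complex.norm_exp_ofReal_mul_I _
  have h2 : ‖z ^ 2‖ < 1 := by
    rw [norm_pow]; exact pow_lt_one₀ (norm_nonneg _) hz two_ne_zero
  rw [mem_regularSet_iff]
  refine ⟨h0, ?_, ?_, ?_, ?_, ?_⟩ <;> intro h' <;> rw [h'] at h2 <;> simp [h] at h2

end RegularSet

/-! ### Symmetries of `μ₂` and the size of its real part near the circle. -/

section Mu

variable {c ω : ℝ} {z : ℂ}

/-- This symmetry lets inversion of `z` turn the decaying approximate solution into the growing one.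
-/
lemma mu2_inv (hz : z ≠ 0) : mu2 c ω z⁻¹ = -mu2 c ω z := by
  have key : ∀ e : ℂ, (c : ℂ) ^ 2 * z⁻¹ ^ 2 * (1 + z⁻¹ ^ 2) * e /
      (4 * (1 - z⁻¹ ^ 2) * (z⁻¹ ^ 2 - e) * (1 - z⁻¹ ^ 2 * e)) =
      -((c : ℂ) ^ 2 * z ^ 2 * (1 + z ^ 2) * e /
        (4 * (1 - z ^ 2) * (z ^ 2 - e) * (1 - z ^ 2 * e))) := by
    intro e
    rw [← mul_div_mul_right _ _ (pow_ne_zero 6 hz), ← neg_div_neg_eq (_ * z ^ 6), ← neg_div]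
    congr 1 <;> (field_simp; ring)
  exact key _

lemma conj_mu2 : (starRingEnd ℂ) (mu2 c ω z) = mu2 c ω ((starRingEnd ℂ) z) := by
  have he : (starRingEnd ℂ) (Complex.exp (2 * Complex.I * ω)) =
      (Complex.exp (2 * Complex.I * ω))⁻¹ := by
    rw [← Complex.exp_conj, ← Complex.exp_neg]; simp [Complex.conj_ofNat]
  have he0 := Complex.exp_ne_zero (2 * Complex.I * ω)
  simp only [mu2, map_div₀, map_mul, map_pow, map_add, map_sub, map_one, map_ofNat, he,
    Complex.conj_ofReal]
  generalize Complex.exp (2 * Complex.I * ω) = e at *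
  generalize (starRingEnd ℂ) z = w
  rw [← mul_div_mul_right _ _ (pow_ne_zero 2 he0)]
  congr 1 <;> field_simp <;> ring

lemma analyticAt_mu2 (hz : z ∈ regularSet ω) : AnalyticAt ℂ (mu2 c ω) z := by
  obtain ⟨h0, h1, h2, h3, -⟩ := mem_regularSet_iff.mp hz
  have he0 := Complex.exp_ne_zero (2 * Complex.I * ω)
  unfold mu2
  refine AnalyticAt.div (by fun_prop) (by fun_prop) ?_
  refine mul_ne_zero (mul_ne_zero (mul_ne_zero (by norm_num) ?_) (sub_ne_zero.mpr h2)) ?_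
  · exact sub_ne_zero.mpr h1.symm
  · rw [sub_ne_zero]
    exact fun h => h3 (eq_inv_of_mul_eq_one_left h.symm)

/-- Reflection in the circle: conjugation commutes with `μ₂` and inversion negates it. The two
points on the right coincide on the circle, so the real part vanishes there. -/
lemma re_mu2_eq (hz : z ≠ 0) :
    (((mu2 c ω z).re : ℝ) : ℂ) = (mu2 c ω z - mu2 c ω ((starRingEnd ℂ) z)⁻¹) / 2 := by
  rw [mu2_inv (by simpa using hz), ← conj_mu2, Complex.re_eq_add_conj, sub_neg_eq_add]

lemma re_mu2_of_norm_eq_one (hz : ‖z‖ = 1) : (mu2 c ω z).re = 0 := by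
  have h0 : z ≠ 0 := by rintro rfl; simp at hz
  have : ((starRingEnd ℂ) z)⁻¹ = z := by
    rw [← Complex.inv_eq_conj hz, inv_inv]
  have h := re_mu2_eq (c := c) (ω := ω) h0
  rw [this, sub_self, zero_div] at h
  exact_mod_cast h

/-- Near a regular point of the closed disc, `Re μ₂` is bounded by a multiple of `1 - |z|`. -/
lemma exists_re_mu2_bound (hz : z ∈ regularSet ω) (hz1 : ‖z‖ ≤ 1) :
    ∃ K : ℝ, 0 ≤ K ∧ ∀ᶠ w in 𝓝[Metric.closedBall 0 1] z, |(mu2 c ω w).re| ≤ K * (1 - ‖w‖) := by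
  have h0 := (mem_regularSet_iff.mp hz).1
  have hpos := norm_pos_iff.mpr h0
  rcases hz1.lt_or_eq with hlt | heq
  · have h1 : ∀ᶠ w in 𝓝 z, ‖mu2 c ω w‖ < ‖mu2 c ω z‖ + 1 :=
      ((analyticAt_mu2 hz).continuousAt.norm).eventually_lt continuousAt_const (by linarith)
    have h2 : ∀ᶠ w in 𝓝 z, ‖w‖ < (1 + ‖z‖) / 2 :=
      continuousAt_id.norm.eventually_lt continuousAt_const (by simp only [id]; linarith)
    refine ⟨(‖mu2 c ω z‖ + 1) * (2 / (1 - ‖z‖)), ?_, nhdsWithin_le_nhds ?_⟩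
    · have : 0 < 1 - ‖z‖ := by linarith
      positivity
    · filter_upwards [h1, h2] with w hw1 hw2
      refine (Complex.abs_re_le_norm _).trans (hw1.le.trans ?_)
      rw [mul_assoc]
      refine le_mul_of_one_le_right (by positivity) ?_
      rw [div_mul_eq_mul_div, one_le_div (by linarith)]
      linarith
  -- At a boundary point, `Re μ₂(w)` is half the difference of `μ₂` at `w` and at its reflection, so
  -- a local Lipschitz bound suffices.
  · obtain ⟨K, t, ht, hK⟩ := ((analyticAt_mu2 (c := c) hz).contDiffAt (n := 1)).exists_lipschitzOnWith
    have hcont : Tendsto (fun w => ((starRingEnd ℂ) w)⁻¹) (𝓝 z) (𝓝 z) := by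
      have h : ContinuousAt (fun w => ((starRingEnd ℂ) w)⁻¹) z :=
        Complex.continuous_conj.continuousAt.inv₀ (by simpa using h0)
      have h2 : ((starRingEnd ℂ) z)⁻¹ = z := by rw [← Complex.inv_eq_conj heq, inv_inv]
      simpa only [ContinuousAt, h2] using h
    have hhalf : ∀ᶠ w in 𝓝 z, 1 / 2 < ‖w‖ :=
      continuousAt_const.eventually_lt continuousAt_id.norm (by simp only [heq]; norm_num)
    refine ⟨2 * K, by positivity, ?_⟩
    filter_upwards [nhdsWithin_le_nhds ht, nhdsWithin_le_nhds (hcont ht),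
      nhdsWithin_le_nhds hhalf, self_mem_nhdsWithin] with w hw1 hw2 hw3 hw4
    have hw0 : w ≠ 0 := by rintro rfl; simp at hw3; linarith
    have hw4 : ‖w‖ ≤ 1 := by simpa using hw4
    have hw : 0 < ‖w‖ := norm_pos_iff.mpr hw0
    -- The distance is `(1 - |w|²)/|w|`; the `4` uses `1 + |w| ≤ 2` and `|w| > 1/2`.
    have hn : ‖w - ((starRingEnd ℂ) w)⁻¹‖ ≤ 4 * (1 - ‖w‖) := by
      have : w - ((starRingEnd ℂ) w)⁻¹ = -(((1 - ‖w‖ ^ 2 : ℝ) : ℂ) * ((starRingEnd ℂ) w)⁻¹) := by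
        have hc : (starRingEnd ℂ) w ≠ 0 := by simpa using hw0
        field_simp
        rw [Complex.mul_conj, Complex.normSq_eq_norm_sq]
        push_cast; ring
      rw [this, norm_neg, norm_mul, norm_inv, RCLike.norm_conj, Complex.norm_real,
        Real.norm_of_nonneg (by nlinarith), ← div_eq_mul_inv, div_le_iff₀ hw]
      nlinarith
    have hL := hK.norm_sub_le hw1 hw2
    have hre : |(mu2 c ω w).re| = ‖mu2 c ω w - mu2 c ω ((starRingEnd ℂ) w)⁻¹‖ / 2 := by
      rw [← Complex.norm_of_nonneg (abs_nonneg _), Complex.norm_real, Real.norm_eq_abs, abs_abs,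
        ← Real.norm_eq_abs, ← Complex.norm_real, re_mu2_eq hw0, norm_div, Complex.norm_ofNat]
    rw [hre]
    have := mul_le_mul_of_nonneg_left hn K.coe_nonneg
    linarith

end Mu

/-! ### Calculus of bounded families and the residual of the ansatz. -/

section Bounded

variable {ι : Type*} {l : Filter ι} {f g : ι → ℂ} {ρ : ι → ℝ}

lemma bounded_mul (hf : f =O[l] (1 : ι → ℝ)) (hg : g =O[l] (1 : ι → ℝ)) :
    (fun i => f i * g i) =O[l] (1 : ι → ℝ) := 
  (hf.mul hg).congr_right (by simp)

lemma bounded_add (hf : f =O[l] (1 : ι → ℝ)) (hg : g =O[l] (1 : ι → ℝ)) :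
    (fun i => f i + g i) =O[l] (1 : ι → ℝ) := hf.add hg

lemma bounded_sub (hf : f =O[l] (1 : ι → ℝ)) (hg : g =O[l] (1 : ι → ℝ)) :
    (fun i => f i - g i) =O[l] (1 : ι → ℝ) := hf.sub hg

lemma bounded_pow (hf : f =O[l] (1 : ι → ℝ)) (n : ℕ) :
    (fun i => f i ^ n) =O[l] (1 : ι → ℝ) := (hf.pow n).congr_right (by simp)

lemma bounded_const (a : ℂ) : (fun _ => a) =O[l] (1 : ι → ℝ) :=
  isBigO_const_const a one_ne_zero l

lemma small_mul_bounded (hg : g =O[l] ρ) (hf : f =O[l] (1 : ι → ℝ)) :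
    (fun i => g i * f i) =O[l] ρ := 
  (hg.mul hf).congr_right (by simp)

lemma isBigO_exp_sub_one_sub (hf : Tendsto f l (𝓝 0)) :
    (fun i => Complex.exp (f i) - 1 - f i) =O[l] fun i => f i ^ 2 := by
  refine IsBigO.of_bound 1 ?_
  have h : ∀ᶠ i in l, ‖f i‖ < 1 := by
    have := hf.norm
    rw [norm_zero] at this
    exact this.eventually_lt_const one_pos
  filter_upwards [h] with i hi
  rw [one_mul, norm_pow]
  exact Complex.norm_exp_sub_one_sub_id_le hi.le

/-- The residual of the second order ansatz in the recurrence: if the coefficients solve the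
equations of first and second order, only terms of third order and variation terms remain. -/
lemma isBigO_ansatz_residual {z w x₁ x₂ y₁ y₂ μ X Y dp dm q t tp tm : ι → ℂ} {e f α β : ℂ}
    (hz : z =O[l] (1 : ι → ℝ)) (hw : w =O[l] (1 : ι → ℝ))
    (hx₁ : x₁ =O[l] (1 : ι → ℝ)) (hx₂ : x₂ =O[l] (1 : ι → ℝ))
    (hy₁ : y₁ =O[l] (1 : ι → ℝ)) (hy₂ : y₂ =O[l] (1 : ι → ℝ)) (hμ : μ =O[l] (1 : ι → ℝ))
    (hX : X =O[l] (1 : ι → ℝ)) (hY : Y =O[l] (1 : ι → ℝ))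
    (ht : t =O[l] (1 : ι → ℝ)) (htp : tp =O[l] (1 : ι → ℝ)) (htm : tm =O[l] (1 : ι → ℝ))
    (ht3 : (fun i => t i ^ 3) =O[l] ρ) (hdtp : (fun i => tp i - t i) =O[l] ρ)
    (hdtm : (fun i => tm i - t i) =O[l] ρ) (hdp : dp =O[l] ρ) (hdm : dm =O[l] ρ)
    (hq : q =O[l] ρ)
    (hXY : ∀ᶠ i in l, X i * Y i = 1)
    (h₁ : ∀ᶠ i in l, x₁ i * (z i * e + w i * f - z i - w i) + α = 0)
    (h₂ : ∀ᶠ i in l, x₂ i * (z i * f + w i * e - z i - w i) + β = 0)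
    (h₃ : ∀ᶠ i in l, y₁ i * (z i * e ^ 2 + w i * f ^ 2 - z i - w i) + α * x₁ i = 0)
    (h₄ : ∀ᶠ i in l, y₂ i * (z i * f ^ 2 + w i * e ^ 2 - z i - w i) + β * x₂ i = 0)
    (h₅ : ∀ᶠ i in l, μ i * (w i - z i) + α * x₂ i + β * x₁ i = 0) :
    (fun i =>
      z i * (1 - μ i * t i ^ 2 + dp i) * (1 + (tp i * (x₁ i * (e * X i) + x₂ i * (f * Y i)) +
        tp i ^ 2 * (y₁ i * (e * X i) ^ 2 + y₂ i * (f * Y i) ^ 2))) +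
      w i * (1 + μ i * t i ^ 2 + dm i) * (1 + (tm i * (x₁ i * (f * X i) + x₂ i * (e * Y i)) +
        tm i ^ 2 * (y₁ i * (f * X i) ^ 2 + y₂ i * (e * Y i) ^ 2))) -
      (z i + w i - (t i * (α * X i + β * Y i) + q i)) *
        (1 + (t i * (x₁ i * X i + x₂ i * Y i) + t i ^ 2 * (y₁ i * X i ^ 2 + y₂ i * Y i ^ 2))))
      =O[l] ρ := by
  -- This is the residual after orders `t` and `t²` have cancelled: every summand is a factor of
  -- size `ρ` times a bounded one.
  have key : (fun i =>
      t i ^ 3 * (w i * μ i * (x₁ i * (f * X i) + x₂ i * (e * Y i) +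
            t i * (y₁ i * (f * X i) ^ 2 + y₂ i * (e * Y i) ^ 2)) -
          z i * μ i * (x₁ i * (e * X i) + x₂ i * (f * Y i) +
            t i * (y₁ i * (e * X i) ^ 2 + y₂ i * (f * Y i) ^ 2)) +
          (α * X i + β * Y i) * (y₁ i * X i ^ 2 + y₂ i * Y i ^ 2)) +
      q i * (1 + (t i * (x₁ i * X i + x₂ i * Y i) +
        t i ^ 2 * (y₁ i * X i ^ 2 + y₂ i * Y i ^ 2))) +
      (tp i - t i) * (z i * (1 - μ i * t i ^ 2) * (x₁ i * (e * X i) + x₂ i * (f * Y i) +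
        (tp i + t i) * (y₁ i * (e * X i) ^ 2 + y₂ i * (f * Y i) ^ 2))) +
      (tm i - t i) * (w i * (1 + μ i * t i ^ 2) * (x₁ i * (f * X i) + x₂ i * (e * Y i) +
        (tm i + t i) * (y₁ i * (f * X i) ^ 2 + y₂ i * (e * Y i) ^ 2))) +
      dp i * (z i * (1 + (tp i * (x₁ i * (e * X i) + x₂ i * (f * Y i)) +
        tp i ^ 2 * (y₁ i * (e * X i) ^ 2 + y₂ i * (f * Y i) ^ 2)))) +
      dm i * (w i * (1 + (tm i * (x₁ i * (f * X i) + x₂ i * (e * Y i)) +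
        tm i ^ 2 * (y₁ i * (f * X i) ^ 2 + y₂ i * (e * Y i) ^ 2))))) =O[l] ρ := by
    refine ((((IsBigO.add ?_ ?_).add ?_).add ?_).add ?_).add ?_ <;>
    refine small_mul_bounded (by assumption) ?_ <;>
    repeat' first
      | assumption | exact bounded_const _ | apply bounded_add | apply bounded_sub
      | apply bounded_mul
  refine key.congr' ?_ EventuallyEq.rfl
  filter_upwards [hXY, h₁, h₂, h₃, h₄, h₅] with i hXY h₁ h₂ h₃ h₄ h₅
  -- One equation for each monomial `tX`, `tY`, `t²X²`, `t²Y²`, and `h₅` for the resonant part;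
  -- `hXY` reduces the cross term `XY` to a constant.
  linear_combination -t i * X i * h₁ - t i * Y i * h₂ - t i ^ 2 * X i ^ 2 * h₃ -
    t i ^ 2 * Y i ^ 2 * h₄ - t i ^ 2 * h₅ - t i ^ 2 * (α * x₂ i + β * x₁ i) * hXY

end Bounded

/-! ### Construction of the approximate Jost solution. -/

/-- The symbol of the free recurrence at `z * a` minus its value at `z`. -/
noncomputable def symbolDiff (a z : ℂ) : ℂ := z * a + z⁻¹ * a⁻¹ - z - z⁻¹

/-- The frequency `e^{2iω}` of the perturbation. -/
noncomputable def freq (ω : ℝ) : ℂ := Complex.exp (2 * Complex.I * ω)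

/-- The amplitude of `e^{2iωn}` in `c sin(2ωn + δ)`. -/
noncomputable def ampPos (c δ : ℝ) : ℂ := c * Complex.exp (Complex.I * δ) / (2 * Complex.I)

/-- The amplitude of `e^{-2iωn}` in `c sin(2ωn + δ)`. -/
noncomputable def ampNeg (c δ : ℝ) : ℂ := -(c * Complex.exp (-(Complex.I * δ)) / (2 * Complex.I))

/-- The first order coefficient of the approximate solution. -/
noncomputable def firstCoeff (A a z : ℂ) : ℂ := -A / symbolDiff a z

/-- The second order coefficient of the approximate solution. -/
noncomputable def secondCoeff (A a z : ℂ) : ℂ := A ^ 2 / (symbolDiff a z * symbolDiff (a ^ 2) z)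

/-- The amplitude correction of the approximate solution. -/
noncomputable def jostCorr (c ω δ γ : ℝ) (n : ℕ) (z : ℂ) : ℂ :=
  (decay γ n : ℂ) * (firstCoeff (ampPos c δ) (freq ω) z * freq ω ^ n +
      firstCoeff (ampNeg c δ) (freq ω)⁻¹ z * (freq ω)⁻¹ ^ n) +
    (decay γ n : ℂ) ^ 2 * (secondCoeff (ampPos c δ) (freq ω) z * (freq ω ^ n) ^ 2 +
      secondCoeff (ampNeg c δ) (freq ω)⁻¹ z * ((freq ω)⁻¹ ^ n) ^ 2)

/-- The leading behaviour `z ^ n exp(-μ₂(z) n^{1-2γ} / (1-2γ))` of the Jost solution. -/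
noncomputable def jostPhase (c ω γ : ℝ) (n : ℕ) (z : ℂ) : ℂ :=
  z ^ n * Complex.exp (-phaseExponent c ω γ z n)

/-- The approximate Jost solution. -/
noncomputable def jostApprox (c ω δ γ : ℝ) (n : ℕ) (z : ℂ) : ℂ :=
  jostPhase c ω γ n z * (1 + jostCorr c ω δ γ n z)

/-- A summable majorant of the residual of the approximate solution. -/
noncomputable def errorBound (γ : ℝ) (q : ℕ → ℝ) (n : ℕ) : ℝ :=
  |q (n + 1)| + decay γ n ^ 3 + (decay γ n - decay γ (n + 2))

section

variable {c ω δ γ : ℝ} {q : ℕ → ℝ} {z : ℂ} {n : ℕ}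

lemma summable_errorBound (hγ : 1 / 3 < γ) (hq : Summable fun n => |q n|) :
    Summable (errorBound γ q) := by
  have h1 := (summable_nat_add_iff 1).mpr hq
  have h2 := summable_decay_sub (γ := γ) (by linarith)
  have h3 := (summable_nat_add_iff 1).mpr h2
  exact ((h1.add (summable_decay_cube hγ)).add (h2.add h3)).congr fun n => by
    simp only [errorBound]; ring

lemma symbolDiff_eq {a : ℂ} (ha : a ≠ 0) : symbolDiff a z = (a - 1) * (z - z⁻¹ * a⁻¹) := by
  rw [symbolDiff]; field_simp; ring

/-- The symbol `z + 1/z` agrees at `z` and `za` only if the points are equal or mutually inverse. -/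
lemma symbolDiff_ne_zero {a : ℂ} (ha : a ≠ 0) (ha1 : a ≠ 1) (hz : z ≠ 0) (hza : z ^ 2 ≠ a⁻¹) :
    symbolDiff a z ≠ 0 := by
  rw [symbolDiff_eq ha]
  refine mul_ne_zero (sub_ne_zero.mpr ha1) fun h => hza ?_
  have h' : z ^ 2 - a⁻¹ = z * (z - z⁻¹ * a⁻¹) := by field_simp
  rw [← sub_eq_zero, h', h, mul_zero]

lemma freq_ne_zero : freq ω ≠ 0 := Complex.exp_ne_zero _

lemma norm_freq : ‖freq ω‖ = 1 := by
  rw [freq, show 2 * Complex.I * (ω : ℂ) = ((2 * ω : ℝ) : ℂ) * Complex.I by push_cast; ring]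
  exact Complex.norm_exp_ofReal_mul_I _

lemma freq_sq_ne_one (hω : ∀ k : ℤ, 2 * ω ≠ Real.pi * k) : freq ω ^ 2 ≠ 1 := by
  rw [freq, ← Complex.exp_nat_mul, Ne, Complex.exp_eq_one_iff]
  rintro ⟨k, hk⟩
  apply hω k
  have : ((2 * ω : ℝ) : ℂ) = ((Real.pi * k : ℝ) : ℂ) := by
    push_cast at hk ⊢
    have h2 : 2 * Complex.I * (2 * ω) = 2 * Complex.I * (Real.pi * k) := by
      linear_combination hk
    exact mul_left_cancel₀ (by simp) h2
  exact_mod_cast this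

lemma freq_ne_one (hω : ∀ k : ℤ, 2 * ω ≠ Real.pi * k) : freq ω ≠ 1 := fun h =>
  freq_sq_ne_one hω (by rw [h, one_pow])

/-- The four denominators of the coefficients do not vanish on `regularSet ω`. -/
lemma symbolDiff_freq_ne_zero (hω : ∀ k : ℤ, 2 * ω ≠ Real.pi * k) (hz : z ∈ regularSet ω) :
    symbolDiff (freq ω) z ≠ 0 ∧ symbolDiff (freq ω)⁻¹ z ≠ 0 ∧
      symbolDiff (freq ω ^ 2) z ≠ 0 ∧ symbolDiff ((freq ω)⁻¹ ^ 2) z ≠ 0 := by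
  obtain ⟨h0, -, h1, h2, h3, h4⟩ := mem_regularSet_iff.mp hz
  have he := freq_ne_zero (ω := ω)
  have he1 := freq_ne_one hω
  have he2 := freq_sq_ne_one hω
  change z ^ 2 ≠ freq ω at h1
  change z ^ 2 ≠ (freq ω)⁻¹ at h2
  change z ^ 2 ≠ freq ω ^ 2 at h3
  change z ^ 2 ≠ (freq ω)⁻¹ ^ 2 at h4
  refine ⟨symbolDiff_ne_zero he he1 h0 h2,
    symbolDiff_ne_zero (inv_ne_zero he) (by simpa using he1) h0 (by simpa using h1),
    symbolDiff_ne_zero (pow_ne_zero 2 he) he2 h0 (by simpa using h4),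
    symbolDiff_ne_zero (pow_ne_zero 2 (inv_ne_zero he)) (by simpa using he2) h0
      (by simpa using h3)⟩

lemma analyticAt_symbolDiff {a : ℂ} (hz : z ≠ 0) : AnalyticAt ℂ (symbolDiff a) z := by
  unfold symbolDiff
  fun_prop (disch := assumption)

lemma analyticAt_firstCoeff {A a : ℂ} (hz : z ≠ 0) (h : symbolDiff a z ≠ 0) :
    AnalyticAt ℂ (firstCoeff A a) z :=
  analyticAt_const.div (analyticAt_symbolDiff hz) h

lemma analyticAt_secondCoeff {A a : ℂ} (hz : z ≠ 0) (h : symbolDiff a z ≠ 0)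
    (h2 : symbolDiff (a ^ 2) z ≠ 0) : AnalyticAt ℂ (secondCoeff A a) z :=
  analyticAt_const.div ((analyticAt_symbolDiff hz).mul (analyticAt_symbolDiff hz))
    (mul_ne_zero h h2)

lemma analyticAt_jostCorr (hω : ∀ k : ℤ, 2 * ω ≠ Real.pi * k) (hz : z ∈ regularSet ω) :
    AnalyticAt ℂ (jostCorr c ω δ γ n) z := by
  obtain ⟨h1, h2, h3, h4⟩ := symbolDiff_freq_ne_zero hω hz
  have h0 := (mem_regularSet_iff.mp hz).1
  have := analyticAt_firstCoeff (A := ampPos c δ) h0 h1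
  have := analyticAt_firstCoeff (A := ampNeg c δ) h0 h2
  have := analyticAt_secondCoeff (A := ampPos c δ) h0 h1 h3
  have := analyticAt_secondCoeff (A := ampNeg c δ) h0 h2 h4
  unfold jostCorr
  fun_prop

lemma analyticAt_jostPhase (hz : z ∈ regularSet ω) : AnalyticAt ℂ (jostPhase c ω γ n) z := by
  have := analyticAt_mu2 (c := c) hz
  unfold jostPhase phaseExponent
  simp only [div_eq_mul_inv]
  fun_prop

lemma analyticAt_jostApprox (hω : ∀ k : ℤ, 2 * ω ≠ Real.pi * k) (hz : z ∈ regularSet ω) :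
    AnalyticAt ℂ (jostApprox c ω δ γ n) z :=
  (analyticAt_jostPhase hz).mul (analyticAt_const.add (analyticAt_jostCorr hω hz))

lemma jostPhase_ne_zero (hz : z ≠ 0) : jostPhase c ω γ n z ≠ 0 :=
  mul_ne_zero (pow_ne_zero _ hz) (Complex.exp_ne_zero _)

lemma jostPhase_inv (hz : z ≠ 0) : jostPhase c ω γ n z⁻¹ = (jostPhase c ω γ n z)⁻¹ := by
  rw [jostPhase, jostPhase, phaseExponent, phaseExponent, mu2_inv hz, mul_inv, inv_pow,
    ← Complex.exp_neg]
  congr 2; ring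

lemma jostPhase_succ : jostPhase c ω γ (n + 1) z =
    jostPhase c ω γ n z * (z * Complex.exp (-(mu2 c ω z * phaseStep γ n))) := by
  have : -phaseExponent c ω γ z (n + 1) =
      -phaseExponent c ω γ z n + -(mu2 c ω z * phaseStep γ n) := by
    simp only [phaseExponent, phaseStep]
    push_cast
    ring
  rw [jostPhase, jostPhase, this, Complex.exp_add]
  ring

lemma jostPhase_eq_succ_mul (hz : z ≠ 0) : jostPhase c ω γ n z =
    jostPhase c ω γ (n + 1) z * (z⁻¹ * Complex.exp (mu2 c ω z * phaseStep γ n)) := by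
  rw [jostPhase_succ, Complex.exp_neg]
  have := Complex.exp_ne_zero (mu2 c ω z * phaseStep γ n)
  field_simp

/-- The exponent `μ₂` is the one produced by the second order resonance. -/
lemma mu2_mul_eq (hω : ∀ k : ℤ, 2 * ω ≠ Real.pi * k) (hz : z ∈ regularSet ω) :
    mu2 c ω z * (z⁻¹ - z) + ampPos c δ * firstCoeff (ampNeg c δ) (freq ω)⁻¹ z +
      ampNeg c δ * firstCoeff (ampPos c δ) (freq ω) z = 0 := by
  obtain ⟨h0, h1, h2, h3, -⟩ := mem_regularSet_iff.mp hz
  have he := freq_ne_zero (ω := ω)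
  have he1 := freq_ne_one hω
  change z ^ 2 ≠ freq ω at h2
  change z ^ 2 ≠ (freq ω)⁻¹ at h3
  have hamp : ampPos c δ * ampNeg c δ = (c : ℂ) ^ 2 / 4 := by
    rw [ampPos, ampNeg, Complex.exp_neg]
    have := Complex.exp_ne_zero (Complex.I * δ)
    field_simp
    rw [Complex.I_sq]; norm_num
  have hmu : mu2 c ω z = (c : ℂ) ^ 2 * z ^ 2 * (1 + z ^ 2) * freq ω /
    (4 * (1 - z ^ 2) * (z ^ 2 - freq ω) * (1 - z ^ 2 * freq ω)) := rfl
  have hs : ampPos c δ * firstCoeff (ampNeg c δ) (freq ω)⁻¹ z +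
      ampNeg c δ * firstCoeff (ampPos c δ) (freq ω) z =
      -(c : ℂ) ^ 2 / 4 * (1 / symbolDiff (freq ω)⁻¹ z + 1 / symbolDiff (freq ω) z) := by
    rw [firstCoeff, firstCoeff, neg_div ((4 : ℂ)), ← hamp]; ring
  rw [add_assoc, hs, hmu, symbolDiff_eq he, symbolDiff_eq (inv_ne_zero he)]
  generalize freq ω = e at *
  have d1 : 1 - z ^ 2 ≠ 0 := sub_ne_zero.mpr h1.symm
  have d2 : z ^ 2 - e ≠ 0 := sub_ne_zero.mpr h2
  have d3 : 1 - z ^ 2 * e ≠ 0 := by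
    rw [sub_ne_zero]; exact fun h => h3 (eq_inv_of_mul_eq_one_left h.symm)
  have d4 : e - 1 ≠ 0 := sub_ne_zero.mpr he1
  have e1 : (e - 1) * (z - z⁻¹ * e⁻¹) = -((e - 1) * (1 - z ^ 2 * e)) / (z * e) := by
    field_simp; ring
  have e2 : (e⁻¹ - 1) * (z - z⁻¹ * e⁻¹⁻¹) = -((e - 1) * (z ^ 2 - e)) / (z * e) := by
    field_simp; ring
  rw [e1, e2]
  field_simp
  ring

lemma sin_eq_amp (n : ℕ) : ((c * Real.sin (2 * ω * n + δ) : ℝ) : ℂ) =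
    ampPos c δ * freq ω ^ n + ampNeg c δ * (freq ω)⁻¹ ^ n := by
  have h1 : Complex.exp (Complex.I * δ) * freq ω ^ n =
      Complex.exp ((2 * ω * n + δ) * Complex.I) := by
    rw [freq, ← Complex.exp_nat_mul, ← Complex.exp_add]; congr 1; ring
  have h2 : Complex.exp (-(Complex.I * δ)) * (freq ω)⁻¹ ^ n =
      Complex.exp (-(2 * ω * n + δ) * Complex.I) := by
    rw [freq, ← Complex.exp_neg, ← Complex.exp_nat_mul, ← Complex.exp_add]; congr 1; ring
  rw [ampPos, ampNeg]
  push_cast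
  rw [Complex.sin, ← h1, ← h2]
  have := Complex.I_ne_zero
  field_simp
  rw [Complex.I_sq]
  ring

end

/-! ### Summable bound for the residual, locally uniform in `z`. -/

/-- The residual of the approximate Jost solution in the recurrence. -/
noncomputable def jostResidual (c ω δ γ : ℝ) (b : ℕ → ℝ) (n : ℕ) (z : ℂ) : ℂ :=
  jostApprox c ω δ γ (n + 2) z + jostApprox c ω δ γ n z -
    (z + z⁻¹ - b (n + 1)) * jostApprox c ω δ γ (n + 1) z

section

variable {c ω δ γ : ℝ} {q b : ℕ → ℝ} {z₀ : ℂ}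

lemma secondCoeff_mul_add {A a z : ℂ} (h : symbolDiff a z ≠ 0) (h2 : symbolDiff (a ^ 2) z ≠ 0) :
    secondCoeff A a z * symbolDiff (a ^ 2) z + A * firstCoeff A a z = 0 := by
  rw [secondCoeff, firstCoeff]
  generalize symbolDiff a z = s at *
  generalize symbolDiff (a ^ 2) z = t at *
  field_simp
  ring

lemma isBigO_comp_snd {f : ℂ → ℂ} (hf : ContinuousAt f z₀) :
    (fun p : ℕ × ℂ => f p.2) =O[atTop ×ˢ 𝓝 z₀] (1 : ℕ × ℂ → ℝ) :=
  (hf.tendsto.isBigO_one ℝ).comp_tendsto tendsto_snd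

lemma isBigO_ofReal_fst {l : Filter ℂ} {f g : ℕ → ℝ} (C : ℝ)
    (hf : ∀ n, 1 ≤ n → |f n| ≤ C * |g n|) :
    (fun p : ℕ × ℂ => (f p.1 : ℂ)) =O[atTop ×ˢ l] (fun p => g p.1) := by
  have h : (fun n => (f n : ℂ)) =O[atTop] g := by
    refine IsBigO.of_bound C ?_
    filter_upwards [eventually_ge_atTop 1] with n hn
    simpa using hf n hn
  exact h.comp_tendsto tendsto_fst

/-- Collects what the linear arithmetic needs to compare each error term with the majorant, with
`errorBound` unfolded. -/
lemma decay_bounds (hγ : 0 < γ) (q : ℕ → ℝ) {n : ℕ} (hn : 1 ≤ n) :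
    0 ≤ decay γ (n + 2) ∧ decay γ (n + 2) ≤ decay γ (n + 1) ∧ decay γ (n + 1) ≤ decay γ n ∧
      decay γ n ≤ 1 ∧ |q (n + 1)| + decay γ n ^ 3 + (decay γ n - decay γ (n + 2)) ≤
        |errorBound γ q n| :=
  ⟨decay_nonneg _, decay_succ_le hγ (by omega), decay_succ_le hγ hn, decay_le_one hγ n,
    le_abs_self _⟩

lemma abs_sub_sq_le_of_mem_Icc {s t u v : ℝ} (hs : s ∈ Set.Icc (u ^ 2) (v ^ 2)) (hu : 0 ≤ u)
    (huv : u ≤ v) (hv : v ≤ 1) (ht : t = u ∨ t = v) : |s - t ^ 2| ≤ 2 * (v - u) := by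
  have : v ^ 2 - u ^ 2 ≤ 2 * (v - u) := by nlinarith
  rw [abs_le]
  rcases ht with rfl | rfl <;> constructor <;> linarith [hs.1, hs.2]

/-- Expand `e^x = 1 + x + O(x²)` at `x = mτ`: `hτ2` controls the quadratic remainder and `hτ1` the
replacement of `τ` by `t²`. It serves the forward and the backward phase ratio alike. -/
lemma isBigO_exp_phase {m : ℂ → ℂ} {τ : ℕ → ℝ} (hm : ContinuousAt m z₀)
    (hτ0 : Tendsto τ atTop (𝓝 0))
    (hτ1 : ∀ n, 1 ≤ n → |τ n - decay γ (n + 1) ^ 2| ≤ 2 * |errorBound γ q n|)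
    (hτ2 : ∀ n, 1 ≤ n → |τ n ^ 2| ≤ 1 * |errorBound γ q n|) :
    (fun p : ℕ × ℂ => Complex.exp (m p.2 * τ p.1) - 1 - m p.2 * (decay γ (p.1 + 1) : ℂ) ^ 2)
      =O[atTop ×ˢ 𝓝 z₀] fun p => errorBound γ q p.1 := by
  have h1 : Tendsto (fun p : ℕ × ℂ => m p.2 * τ p.1) (atTop ×ˢ 𝓝 z₀) (𝓝 0) := by
    have := (hm.tendsto.comp (tendsto_snd (f := (atTop : Filter ℕ)))).mul
      (((Complex.continuous_ofReal.tendsto 0).comp hτ0).comp (tendsto_fst (g := 𝓝 z₀)))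
    simpa using this
  have hm' := isBigO_comp_snd hm
  have h2 : (fun p : ℕ × ℂ => (m p.2 * τ p.1) ^ 2) =O[atTop ×ˢ 𝓝 z₀]
      fun p => errorBound γ q p.1 := by
    have := small_mul_bounded (isBigO_ofReal_fst (l := 𝓝 z₀) _ hτ2) (bounded_pow hm' 2)
    refine this.congr_left fun p => ?_
    push_cast; ring
  have h3 := small_mul_bounded (isBigO_ofReal_fst (l := 𝓝 z₀) _ hτ1) hm'
  refine (((isBigO_exp_sub_one_sub h1).trans h2).add h3).congr_left fun p => ?_
  push_cast; ring

lemma isBigO_freq_pow (f : ℂ) (hf : ‖f‖ = 1) (l : Filter (ℕ × ℂ)) :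
    (fun p : ℕ × ℂ => f ^ (p.1 + 1)) =O[l] (1 : ℕ × ℂ → ℝ) :=
  IsBigO.of_bound 1 (Eventually.of_forall fun p => by simp [hf])

lemma isBigO_decay (hγ : 0 < γ) (k : ℕ) (l : Filter ℂ) :
    (fun p : ℕ × ℂ => (decay γ (p.1 + k) : ℂ)) =O[atTop ×ˢ l] (1 : ℕ × ℂ → ℝ) :=
  isBigO_ofReal_fst (f := fun n => decay γ (n + k)) (g := fun _ => 1) 1 fun n _ => by
    rw [abs_of_nonneg (decay_nonneg _)]; simpa using decay_le_one hγ _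

lemma coe_potential_eq {n : ℕ}
    (hb : ∀ n : ℕ, 1 ≤ n → b n = c * Real.sin (2 * ω * n + δ) / (n : ℝ) ^ γ + q n)
    (hn : 1 ≤ n) : (b n : ℂ) = decay γ n *
      (ampPos c δ * freq ω ^ n + ampNeg c δ * (freq ω)⁻¹ ^ n) + q n := by
  rw [hb n hn, ← sin_eq_amp, decay, Real.rpow_neg (Nat.cast_nonneg n)]
  push_cast
  ring

lemma isBigO_jostResidual (hγ : 0 < γ) (hγ' : γ < 1 / 2) (hω : ∀ k : ℤ, 2 * ω ≠ Real.pi * k)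
    (hb : ∀ n : ℕ, 1 ≤ n → b n = c * Real.sin (2 * ω * n + δ) / (n : ℝ) ^ γ + q n)
    (hz₀ : z₀ ∈ regularSet ω) :
    (fun p : ℕ × ℂ => jostResidual c ω δ γ b p.1 p.2 / jostPhase c ω γ (p.1 + 1) p.2)
      =O[atTop ×ˢ 𝓝 z₀] fun p => errorBound γ q p.1 := by
  have hU : ∀ᶠ p : ℕ × ℂ in atTop ×ˢ 𝓝 z₀, p.2 ∈ regularSet ω :=
    tendsto_snd.eventually ((isOpen_regularSet ω).mem_nhds hz₀)
  obtain ⟨k1, k2, k3, k4⟩ := symbolDiff_freq_ne_zero hω hz₀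
  have h0 := (mem_regularSet_iff.mp hz₀).1
  have hε := @decay_bounds γ hγ q
  have hτ := tendsto_phaseStep hγ hγ'
  have he := freq_ne_zero (ω := ω)
  have hmu := (analyticAt_mu2 (c := c) hz₀).continuousAt
  have key := isBigO_ansatz_residual (l := atTop ×ˢ 𝓝 z₀)
    (ρ := fun p => errorBound γ q p.1) (z := fun p => p.2) (w := fun p => p.2⁻¹)
    (x₁ := fun p => firstCoeff (ampPos c δ) (freq ω) p.2)
    (x₂ := fun p => firstCoeff (ampNeg c δ) (freq ω)⁻¹ p.2)
    (y₁ := fun p => secondCoeff (ampPos c δ) (freq ω) p.2)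
    (y₂ := fun p => secondCoeff (ampNeg c δ) (freq ω)⁻¹ p.2)
    (μ := fun p => mu2 c ω p.2)
    (X := fun p => freq ω ^ (p.1 + 1)) (Y := fun p => (freq ω)⁻¹ ^ (p.1 + 1))
    (dp := fun p => Complex.exp (-mu2 c ω p.2 * phaseStep γ (p.1 + 1)) - 1 -
      -mu2 c ω p.2 * (decay γ (p.1 + 1) : ℂ) ^ 2)
    (dm := fun p => Complex.exp (mu2 c ω p.2 * phaseStep γ p.1) - 1 -
      mu2 c ω p.2 * (decay γ (p.1 + 1) : ℂ) ^ 2)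
    (q := fun p => (q (p.1 + 1) : ℂ))
    (t := fun p => (decay γ (p.1 + 1) : ℂ)) (tp := fun p => (decay γ (p.1 + 2) : ℂ))
    (tm := fun p => (decay γ p.1 : ℂ)) (e := freq ω) (f := (freq ω)⁻¹)
    (α := ampPos c δ) (β := ampNeg c δ)
    (isBigO_comp_snd continuousAt_id) (isBigO_comp_snd (continuousAt_inv₀ h0))
    (isBigO_comp_snd (analyticAt_firstCoeff h0 k1).continuousAt)
    (isBigO_comp_snd (analyticAt_firstCoeff h0 k2).continuousAt)
    (isBigO_comp_snd (analyticAt_secondCoeff h0 k1 k3).continuousAt)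
    (isBigO_comp_snd (analyticAt_secondCoeff h0 k2 k4).continuousAt)
    (isBigO_comp_snd hmu)
    (isBigO_freq_pow _ norm_freq _) (isBigO_freq_pow _ (by rw [norm_inv, norm_freq, inv_one]) _)
    (isBigO_decay hγ 1 _) (isBigO_decay hγ 2 _) (isBigO_decay hγ 0 _)
    (by
      refine (isBigO_ofReal_fst (f := fun n => decay γ (n + 1) ^ 3) 1 fun n hn => ?_).congr_left
        fun p => by push_cast; rfl
      obtain ⟨a1, a2, a3, a4, a5⟩ := hε hn
      rw [abs_of_nonneg (pow_nonneg (a1.trans a2) 3), one_mul]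
      have := pow_le_pow_left₀ (a1.trans a2) a3 3
      linarith [abs_nonneg (q (n + 1))])
    (by
      refine (isBigO_ofReal_fst (f := fun n => decay γ (n + 2) - decay γ (n + 1)) 1
        fun n hn => ?_).congr_left fun p => by push_cast; rfl
      obtain ⟨a1, a2, a3, a4, a5⟩ := hε hn
      have := pow_nonneg (a1.trans (a2.trans a3)) 3
      rw [abs_le]
      constructor <;> linarith [abs_nonneg (q (n + 1))])
    (by
      refine (isBigO_ofReal_fst (f := fun n => decay γ n - decay γ (n + 1)) 1
        fun n hn => ?_).congr_left fun p => by push_cast; rfl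
      obtain ⟨a1, a2, a3, a4, a5⟩ := hε hn
      have := pow_nonneg (a1.trans (a2.trans a3)) 3
      rw [abs_le]
      constructor <;> linarith [abs_nonneg (q (n + 1))])
    (isBigO_exp_phase hmu.neg (hτ.comp (tendsto_add_atTop_nat 1))
      (fun n hn => by
        obtain ⟨a1, a2, a3, a4, a5⟩ := hε hn
        have := abs_sub_sq_le_of_mem_Icc (phaseStep_mem_Icc hγ hγ' (n := n + 1) (by omega)) a1 a2
          (a3.trans a4) (Or.inr rfl)
        have := pow_nonneg (a1.trans (a2.trans a3)) 3
        simp only [Function.comp]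
        linarith [abs_nonneg (q (n + 1))])
      (fun n hn => by
        obtain ⟨a1, a2, a3, a4, a5⟩ := hε hn
        have h := phaseStep_mem_Icc hγ hγ' (n := n + 1) (by omega)
        -- The squared increment is of fourth order in the decay, hence below its cube since the
        -- decay is at most `1`.
        have h2 := pow_le_pow_left₀ ((sq_nonneg _).trans h.1) h.2 2
        have h3 : (decay γ (n + 1) ^ 2) ^ 2 ≤ decay γ n ^ 3 := by
          rw [← pow_mul]
          exact (pow_le_pow_left₀ (a1.trans a2) a3 _).trans
            (pow_le_pow_of_le_one (a1.trans (a2.trans a3)) a4 (by norm_num))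
        simp only [Function.comp, abs_sq]
        linarith [abs_nonneg (q (n + 1))]))
    (isBigO_exp_phase hmu hτ
      (fun n hn => by
        obtain ⟨a1, a2, a3, a4, a5⟩ := hε hn
        have := abs_sub_sq_le_of_mem_Icc (phaseStep_mem_Icc hγ hγ' hn) (a1.trans a2) a3 a4
          (Or.inl rfl)
        have := pow_nonneg (a1.trans (a2.trans a3)) 3
        linarith [abs_nonneg (q (n + 1))])
      (fun n hn => by
        obtain ⟨a1, a2, a3, a4, a5⟩ := hε hn
        have h := phaseStep_mem_Icc hγ hγ' hn
        have h2 := pow_le_pow_left₀ ((sq_nonneg _).trans h.1) h.2 2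
        have h3 : (decay γ n ^ 2) ^ 2 ≤ decay γ n ^ 3 := by
          rw [← pow_mul]
          exact pow_le_pow_of_le_one (a1.trans (a2.trans a3)) a4 (by norm_num)
        rw [abs_sq]
        linarith [abs_nonneg (q (n + 1))]))
    (isBigO_ofReal_fst (f := fun n => q (n + 1)) 1 fun n hn => by
      obtain ⟨a1, a2, a3, a4, a5⟩ := hε hn
      have := pow_nonneg (a1.trans (a2.trans a3)) 3
      linarith)
    (Eventually.of_forall fun p => by
      rw [← mul_pow, mul_inv_cancel₀ he, one_pow])
    (hU.mono fun p hp => by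
      have h := (symbolDiff_freq_ne_zero hω hp).1
      have h' : p.2 * freq ω + p.2⁻¹ * (freq ω)⁻¹ - p.2 - p.2⁻¹ = symbolDiff (freq ω) p.2 := rfl
      rw [h', firstCoeff, div_mul_cancel₀ _ h, neg_add_cancel])
    (hU.mono fun p hp => by
      have h := (symbolDiff_freq_ne_zero hω hp).2.1
      have h' : p.2 * (freq ω)⁻¹ + p.2⁻¹ * freq ω - p.2 - p.2⁻¹ =
        symbolDiff (freq ω)⁻¹ p.2 := by rw [symbolDiff, inv_inv]
      rw [h', firstCoeff, div_mul_cancel₀ _ h, neg_add_cancel])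
    (hU.mono fun p hp => by
      obtain ⟨h1, -, h3, -⟩ := symbolDiff_freq_ne_zero hω hp
      have h' : p.2 * freq ω ^ 2 + p.2⁻¹ * (freq ω)⁻¹ ^ 2 - p.2 - p.2⁻¹ =
        symbolDiff (freq ω ^ 2) p.2 := by rw [symbolDiff, inv_pow]
      rw [h']
      exact secondCoeff_mul_add h1 h3)
    (hU.mono fun p hp => by
      obtain ⟨-, h1, -, h3⟩ := symbolDiff_freq_ne_zero hω hp
      have h' : p.2 * (freq ω)⁻¹ ^ 2 + p.2⁻¹ * freq ω ^ 2 - p.2 - p.2⁻¹ =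
        symbolDiff ((freq ω)⁻¹ ^ 2) p.2 := by rw [symbolDiff, inv_pow, inv_inv]
      rw [h']
      exact secondCoeff_mul_add h1 h3)
    (hU.mono fun p hp => mu2_mul_eq hω hp)
  refine key.congr' ?_ EventuallyEq.rfl
  filter_upwards [hU] with p hp
  obtain ⟨n, z⟩ := p
  have hz := (mem_regularSet_iff.mp hp).1
  have hph := jostPhase_ne_zero (c := c) (ω := ω) (γ := γ) (n := n + 1) hz
  dsimp only
  rw [eq_div_iff hph, jostResidual, jostApprox, jostApprox, jostApprox,
    jostPhase_eq_succ_mul (n := n) hz, jostPhase_succ (n := n + 1),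
    coe_potential_eq hb (by omega : 1 ≤ n + 1)]
  -- The ansatz is centred at `n + 1`: its neighbours differ by a factor `freq ω` or its inverse,
  -- matching `e` and `f`.
  have hX1 : freq ω ^ (n + 2) = freq ω * freq ω ^ (n + 1) := pow_succ' _ _
  have hX2 : freq ω ^ n = (freq ω)⁻¹ * freq ω ^ (n + 1) := by
    rw [pow_succ']; field_simp
  have hY1 : (freq ω)⁻¹ ^ (n + 2) = (freq ω)⁻¹ * (freq ω)⁻¹ ^ (n + 1) := pow_succ' _ _
  have hY2 : (freq ω)⁻¹ ^ n = freq ω * (freq ω)⁻¹ ^ (n + 1) := by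
    rw [pow_succ']; field_simp
  rw [jostCorr, jostCorr, jostCorr, hX1, hX2, hY1, hY2, neg_mul]
  ring

lemma tendsto_jostCorr (hγ : 0 < γ) (hω : ∀ k : ℤ, 2 * ω ≠ Real.pi * k)
    (hz₀ : z₀ ∈ regularSet ω) :
    Tendsto (fun p : ℕ × ℂ => jostCorr c ω δ γ p.1 p.2) (atTop ×ˢ 𝓝 z₀) (𝓝 0) := by
  obtain ⟨k1, k2, k3, k4⟩ := symbolDiff_freq_ne_zero hω hz₀
  have h0 := (mem_regularSet_iff.mp hz₀).1
  have b1 := isBigO_comp_snd (analyticAt_firstCoeff (A := ampPos c δ) h0 k1).continuousAt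
  have b2 := isBigO_comp_snd (analyticAt_firstCoeff (A := ampNeg c δ) h0 k2).continuousAt
  have b3 := isBigO_comp_snd (analyticAt_secondCoeff (A := ampPos c δ) h0 k1 k3).continuousAt
  have b4 := isBigO_comp_snd (analyticAt_secondCoeff (A := ampNeg c δ) h0 k2 k4).continuousAt
  have bX : (fun p : ℕ × ℂ => freq ω ^ p.1) =O[atTop ×ˢ 𝓝 z₀] (1 : ℕ × ℂ → ℝ) :=
    IsBigO.of_bound 1 (Eventually.of_forall fun p => by simp [norm_freq])
  have bY : (fun p : ℕ × ℂ => (freq ω)⁻¹ ^ p.1) =O[atTop ×ˢ 𝓝 z₀] (1 : ℕ × ℂ → ℝ) :=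
    IsBigO.of_bound 1 (Eventually.of_forall fun p => by simp [norm_freq])
  have bT := isBigO_decay hγ 0 (𝓝 z₀)
  have hs : (fun p : ℕ × ℂ => (decay γ p.1 : ℂ)) =O[atTop ×ˢ 𝓝 z₀] fun p => decay γ p.1 :=
    isBigO_ofReal_fst 1 fun n _ => (one_mul _).ge
  have key : (fun p : ℕ × ℂ => jostCorr c ω δ γ p.1 p.2) =O[atTop ×ˢ 𝓝 z₀]
      fun p => decay γ p.1 := by
    refine (small_mul_bounded hs (f := fun p : ℕ × ℂ =>
      (firstCoeff (ampPos c δ) (freq ω) p.2 * freq ω ^ p.1 +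
        firstCoeff (ampNeg c δ) (freq ω)⁻¹ p.2 * (freq ω)⁻¹ ^ p.1) +
      (decay γ p.1 : ℂ) * (secondCoeff (ampPos c δ) (freq ω) p.2 * (freq ω ^ p.1) ^ 2 +
        secondCoeff (ampNeg c δ) (freq ω)⁻¹ p.2 * ((freq ω)⁻¹ ^ p.1) ^ 2)) ?_).congr_left
      fun p => ?_
    · exact bounded_add (bounded_add (bounded_mul b1 bX) (bounded_mul b2 bY))
        (bounded_mul bT (bounded_add (bounded_mul b3 (bounded_pow bX 2))
          (bounded_mul b4 (bounded_pow bY 2))))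
    · rw [jostCorr]; ring
  exact key.trans_tendsto ((tendsto_decay hγ).comp tendsto_fst)

end

/-! ### Gronwall estimate and growth of the polynomials. -/

/-- A discrete Gronwall bound: a solution of a three term recurrence is dominated by the growing
member of a pair of approximate solutions with summable relative residuals. -/
lemma solution_bound_of_approx {P ψ φ lam : ℕ → ℂ} {θ ρ : ℕ → ℝ} {C κ : ℝ} {N : ℕ}
    (hC : 0 ≤ C) (hκ : 0 < κ) (hθ : ∀ n, 0 < θ n) (hρ : Summable fun n => |ρ n|)
    (hP : ∀ n, P (n + 2) = lam n * P (n + 1) - P n)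
    (hψ : ∀ n ≥ N, ‖ψ (n + 2) + ψ n - lam n * ψ (n + 1)‖ ≤ C * |ρ n| * θ (n + 1))
    (hφ : ∀ n ≥ N, ‖φ (n + 2) + φ n - lam n * φ (n + 1)‖ ≤ C * |ρ n| * (θ (n + 1))⁻¹)
    (hψ' : ∀ n ≥ N, ‖ψ n‖ ≤ C * θ n) (hφ' : ∀ n ≥ N, ‖φ n‖ ≤ C * (θ n)⁻¹)
    (hanti : ∀ n ≥ N, θ (n + 1) ≤ θ n)
    (hw : ∀ n ≥ N, κ ≤ ‖ψ n * φ (n + 1) - φ n * ψ (n + 1)‖) :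
    ∀ n ≥ N, ‖P (n + 1)‖ * θ (n + 1) ≤ C / κ *
      ((‖P (N + 1) * ψ N - P N * ψ (N + 1)‖ + ‖P (N + 1) * φ N - P N * φ (N + 1)‖ * θ N ^ 2) *
        Real.exp (2 * C ^ 2 / κ * ∑' k, |ρ k|)) := by
  -- The Wronskians of `P` with both approximate solutions; the weight `θ²` brings the growing one
  -- to the scale of the other.
  set S : ℕ → ℝ := fun n => ‖P (n + 1) * ψ n - P n * ψ (n + 1)‖ +
    ‖P (n + 1) * φ n - P n * φ (n + 1)‖ * θ n ^ 2 with hS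
  have hS0 : ∀ n, 0 ≤ S n := fun n => by positivity
  have hPS : ∀ n ≥ N, ‖P (n + 1)‖ * θ (n + 1) ≤ C / κ * S n := by
    intro n hn
    have ht := hθ (n + 1)
    -- Cramer's rule recovers `P` from the two Wronskians, with determinant at least `κ` in norm.
    have hid : P (n + 1) * (ψ n * φ (n + 1) - φ n * ψ (n + 1)) =
        (P (n + 1) * ψ n - P n * ψ (n + 1)) * φ (n + 1) -
          (P (n + 1) * φ n - P n * φ (n + 1)) * ψ (n + 1) := by ring
    have h1 : ‖P (n + 1)‖ * κ ≤ ‖P (n + 1) * ψ n - P n * ψ (n + 1)‖ * (C * (θ (n + 1))⁻¹) +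
        ‖P (n + 1) * φ n - P n * φ (n + 1)‖ * (C * θ (n + 1)) := by
      calc ‖P (n + 1)‖ * κ ≤ ‖P (n + 1) * (ψ n * φ (n + 1) - φ n * ψ (n + 1))‖ := by
            rw [norm_mul]; gcongr; exact hw n hn
        _ ≤ _ := by
            rw [hid]
            refine (norm_sub_le _ _).trans ?_
            rw [norm_mul, norm_mul]
            gcongr
            exacts [hφ' _ (by omega), hψ' _ (by omega)]
    have h2 : θ (n + 1) ^ 2 ≤ θ n ^ 2 := pow_le_pow_left₀ ht.le (hanti n hn) 2
    rw [div_mul_eq_mul_div, le_div_iff₀ hκ]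
    calc ‖P (n + 1)‖ * θ (n + 1) * κ = ‖P (n + 1)‖ * κ * θ (n + 1) := by ring
      _ ≤ (‖P (n + 1) * ψ n - P n * ψ (n + 1)‖ * (C * (θ (n + 1))⁻¹) +
        ‖P (n + 1) * φ n - P n * φ (n + 1)‖ * (C * θ (n + 1))) * θ (n + 1) := by gcongr
      _ = C * (‖P (n + 1) * ψ n - P n * ψ (n + 1)‖ +
        ‖P (n + 1) * φ n - P n * φ (n + 1)‖ * θ (n + 1) ^ 2) := by field_simp
      _ ≤ C * S n := by
        simp only [hS]; gcongr
  have hstep : ∀ n ≥ N, S (n + 1) ≤ S n * Real.exp (2 * C ^ 2 / κ * |ρ n|) := by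
    intro n hn
    have ht := hθ (n + 1)
    have h2 : θ (n + 1) ^ 2 ≤ θ n ^ 2 := pow_le_pow_left₀ ht.le (hanti n hn) 2
    have e1 : P (n + 2) * ψ (n + 1) - P (n + 1) * ψ (n + 2) =
        (P (n + 1) * ψ n - P n * ψ (n + 1)) -
          P (n + 1) * (ψ (n + 2) + ψ n - lam n * ψ (n + 1)) := by rw [hP]; ring
    have e2 : P (n + 2) * φ (n + 1) - P (n + 1) * φ (n + 2) =
        (P (n + 1) * φ n - P n * φ (n + 1)) -
          P (n + 1) * (φ (n + 2) + φ n - lam n * φ (n + 1)) := by rw [hP]; ring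
    have b1 : ‖P (n + 2) * ψ (n + 1) - P (n + 1) * ψ (n + 2)‖ ≤
        ‖P (n + 1) * ψ n - P n * ψ (n + 1)‖ + ‖P (n + 1)‖ * (C * |ρ n| * θ (n + 1)) := by
      rw [e1]
      refine (norm_sub_le _ _).trans ?_
      rw [norm_mul (P (n + 1))]
      gcongr
      exact hψ n hn
    have b2 : ‖P (n + 2) * φ (n + 1) - P (n + 1) * φ (n + 2)‖ ≤
        ‖P (n + 1) * φ n - P n * φ (n + 1)‖ + ‖P (n + 1)‖ * (C * |ρ n| * (θ (n + 1))⁻¹) := by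
      rw [e2]
      refine (norm_sub_le _ _).trans ?_
      rw [norm_mul (P (n + 1))]
      gcongr
      exact hφ n hn
    calc S (n + 1) ≤
        (‖P (n + 1) * ψ n - P n * ψ (n + 1)‖ + ‖P (n + 1)‖ * (C * |ρ n| * θ (n + 1))) +
        (‖P (n + 1) * φ n - P n * φ (n + 1)‖ + ‖P (n + 1)‖ * (C * |ρ n| * (θ (n + 1))⁻¹)) *
          θ (n + 1) ^ 2 := by
          simp only [hS]; gcongr
      _ = ‖P (n + 1) * ψ n - P n * ψ (n + 1)‖ +
          ‖P (n + 1) * φ n - P n * φ (n + 1)‖ * θ (n + 1) ^ 2 +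
          2 * C * |ρ n| * (‖P (n + 1)‖ * θ (n + 1)) := by field_simp; ring
      _ ≤ S n + 2 * C * |ρ n| * (C / κ * S n) := by
          have := hPS n hn
          simp only [hS] at this ⊢
          gcongr
      _ = S n * (2 * C ^ 2 / κ * |ρ n| + 1) := by ring
      _ ≤ _ := by
          have := hS0 n
          gcongr
          exact Real.add_one_le_exp _
  have hsum : ∀ m, S (N + m) ≤
      S N * Real.exp (2 * C ^ 2 / κ * ∑ k ∈ Finset.range m, |ρ (N + k)|) := by
    intro m
    induction m with
    | zero => simp
    | succ m ih =>
      rw [Finset.sum_range_succ, mul_add, Real.exp_add, ← mul_assoc, ← add_assoc]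
      exact (hstep (N + m) (by omega)).trans (by gcongr)
  intro n hn
  obtain ⟨m, rfl⟩ := Nat.exists_eq_add_of_le hn
  refine (hPS _ hn).trans ?_
  have hle : ∑ k ∈ Finset.range m, |ρ (N + k)| ≤ ∑' k, |ρ k| := by
    refine (Finset.sum_map (Finset.range m) (addLeftEmbedding N) fun k => |ρ k|).symm.le.trans ?_
    exact hρ.sum_le_tsum _ fun _ _ => abs_nonneg _
  have := hS0 N
  have h3 := hsum m
  gcongr
  refine h3.trans ?_
  change S N * _ ≤ S N * _
  gcongr

lemma exists_forall_ge_of_eventually_prod {α : Type*} {l : Filter α} {Q : ℕ × α → Prop}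
    (h : ∀ᶠ p in atTop ×ˢ l, Q p) : ∃ N, ∀ᶠ z in l, ∀ n ≥ N, Q (n, z) := by
  obtain ⟨pa, ha, pb, hb, hab⟩ := eventually_prod_iff.mp h
  obtain ⟨N, hN⟩ := eventually_atTop.mp ha
  exact ⟨N, hb.mono fun z hz n hn => hab (hN n hn) hz⟩

/-- The orthonormal polynomials in the uniformizing variable `z`. -/
noncomputable def jostPoly (b : ℕ → ℝ) (n : ℕ) (z : ℂ) : ℂ := orthoPolyEval b n (z + 1 / z)

lemma jostPoly_add_two (b : ℕ → ℝ) (n : ℕ) (z : ℂ) : jostPoly b (n + 2) z =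
    (z + z⁻¹ - b (n + 1)) * jostPoly b (n + 1) z - jostPoly b n z := by
  simp [jostPoly, orthoPolyEval, orthoPoly]

lemma analyticAt_jostPoly (b : ℕ → ℝ) (n : ℕ) {z : ℂ} (hz : z ≠ 0) :
    AnalyticAt ℂ (jostPoly b n) z := by
  unfold jostPoly orthoPolyEval
  exact AnalyticAt.aeval_polynomial (by fun_prop (disch := assumption)) _

section

variable {c ω δ γ : ℝ} {q b : ℕ → ℝ} {z₀ : ℂ}

lemma tendsto_phase_ratio (hγ : 0 < γ) (hγ' : γ < 1 / 2) (hz₀ : z₀ ∈ regularSet ω) :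
    Tendsto (fun p : ℕ × ℂ => p.2 * Complex.exp (-(mu2 c ω p.2 * phaseStep γ p.1)))
      (atTop ×ˢ 𝓝 z₀) (𝓝 z₀) := by
  have h1 : Tendsto (fun p : ℕ × ℂ => mu2 c ω p.2 * phaseStep γ p.1) (atTop ×ˢ 𝓝 z₀) (𝓝 0) := by
    have := ((analyticAt_mu2 (c := c) hz₀).continuousAt.tendsto.comp
      (tendsto_snd (f := (atTop : Filter ℕ)))).mul
      (((Complex.continuous_ofReal.tendsto 0).comp (tendsto_phaseStep hγ hγ')).comp
        (tendsto_fst (g := 𝓝 z₀)))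
    simpa using this
  have h2 := (Complex.continuous_exp.tendsto _).comp h1.neg
  have h3 := (tendsto_snd (f := (atTop : Filter ℕ)) (g := 𝓝 z₀)).mul h2
  simpa using h3

lemma tendsto_jostPhase_div (hγ : 0 < γ) (hγ' : γ < 1 / 2) (hz₀ : z₀ ∈ regularSet ω) :
    Tendsto (fun p : ℕ × ℂ => jostPhase c ω γ (p.1 + 1) p.2 / jostPhase c ω γ p.1 p.2)
      (atTop ×ˢ 𝓝 z₀) (𝓝 z₀) := by
  refine (tendsto_phase_ratio (c := c) hγ hγ' hz₀).congr' ?_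
  have hU : ∀ᶠ p : ℕ × ℂ in atTop ×ˢ 𝓝 z₀, p.2 ∈ regularSet ω :=
    tendsto_snd.eventually ((isOpen_regularSet ω).mem_nhds hz₀)
  filter_upwards [hU] with p hp
  rw [jostPhase_succ, mul_div_cancel_left₀ _ (jostPhase_ne_zero (mem_regularSet_iff.mp hp).1)]

lemma tendsto_inv_snd (hz₀ : z₀ ≠ 0) :
    Tendsto (fun p : ℕ × ℂ => (p.1, p.2⁻¹)) (atTop ×ˢ 𝓝 z₀) (atTop ×ˢ 𝓝 z₀⁻¹) :=
  tendsto_fst.prodMk ((tendsto_inv₀ hz₀).comp tendsto_snd)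

lemma tendsto_succ_fst (l : Filter ℂ) :
    Tendsto (fun p : ℕ × ℂ => (p.1 + 1, p.2)) (atTop ×ˢ l) (atTop ×ˢ l) :=
  ((tendsto_add_atTop_nat 1).comp tendsto_fst).prodMk tendsto_snd

/-- Any growth of the exponential factor is at most `exp(K(1-|z|)τ_n)`, which is beaten by `|z| ≤
e^{-(1-|z|)}` once `Kτ_n < 1`. This stays uniform up to the circle because `|Re μ₂|` is bounded by a
multiple of `1 - |z|`. -/
lemma eventually_norm_jostPhase_succ_le (hγ : 0 < γ) (hγ' : γ < 1 / 2)
    (hz₀ : z₀ ∈ regularSet ω) (hz₁ : ‖z₀‖ ≤ 1) :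
    ∀ᶠ p : ℕ × ℂ in atTop ×ˢ 𝓝[Metric.closedBall 0 1] z₀,
      ‖jostPhase c ω γ (p.1 + 1) p.2‖ ≤ ‖jostPhase c ω γ p.1 p.2‖ := by
  obtain ⟨K, hK0, hK⟩ := exists_re_mu2_bound (c := c) hz₀ hz₁
  have hτ : ∀ᶠ n in atTop, K * phaseStep γ n < 1 := by
    have := (tendsto_phaseStep hγ hγ').const_mul K
    rw [mul_zero] at this
    exact this.eventually_lt_const one_pos
  filter_upwards [tendsto_fst.eventually (hτ.and (eventually_ge_atTop 1)),
    tendsto_snd.eventually (hK.and self_mem_nhdsWithin)] with p ⟨hp1, hn⟩ ⟨hp2, hp3⟩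
  obtain ⟨n, z⟩ := p
  dsimp only at *
  have hz : ‖z‖ ≤ 1 := by simpa using hp3
  have hτ0 : 0 ≤ phaseStep γ n := (sq_nonneg _).trans (phaseStep_mem_Icc hγ hγ' hn).1
  rw [jostPhase_succ, norm_mul]
  refine mul_le_of_le_one_right (norm_nonneg _) ?_
  rw [norm_mul, Complex.norm_exp, Complex.neg_re, Complex.re_mul_ofReal]
  calc ‖z‖ * Real.exp (-((mu2 c ω z).re * phaseStep γ n))
      ≤ Real.exp (-(1 - ‖z‖)) * Real.exp (K * (1 - ‖z‖) * phaseStep γ n) := by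
        gcongr
        · linarith [Real.add_one_le_exp (-(1 - ‖z‖))]
        · rw [← neg_mul]
          gcongr
          exact (neg_le_abs _).trans hp2
    _ = Real.exp ((K * phaseStep γ n - 1) * (1 - ‖z‖)) := by
        rw [← Real.exp_add]; ring_nf
    _ ≤ 1 := by
        rw [Real.exp_le_one_iff]
        exact mul_nonpos_of_nonpos_of_nonneg (by linarith) (by linarith)

/-- The approximate solutions `jostApprox n z` and `jostApprox n z⁻¹` are independent. -/
lemma tendsto_jostApprox_wronskian (hγ : 0 < γ) (hγ' : γ < 1 / 2)
    (hω : ∀ k : ℤ, 2 * ω ≠ Real.pi * k) (hz₀ : z₀ ∈ regularSet ω) :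
    Tendsto (fun p : ℕ × ℂ =>
      jostApprox c ω δ γ p.1 p.2 * jostApprox c ω δ γ (p.1 + 1) p.2⁻¹ -
        jostApprox c ω δ γ p.1 p.2⁻¹ * jostApprox c ω δ γ (p.1 + 1) p.2)
      (atTop ×ˢ 𝓝 z₀) (𝓝 (z₀⁻¹ - z₀)) := by
  have h0 := (mem_regularSet_iff.mp hz₀).1
  have hr := tendsto_jostPhase_div (c := c) hγ hγ' hz₀
  have hu := (tendsto_jostCorr (c := c) (δ := δ) hγ hω hz₀).const_add 1
  have hv := ((tendsto_jostCorr (c := c) (δ := δ) hγ hω (inv_mem_regularSet hz₀)).comp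
    (tendsto_inv_snd h0)).const_add 1
  have hu1 := hu.comp (tendsto_succ_fst _)
  have hv1 := hv.comp (tendsto_succ_fst _)
  have key := ((hr.inv₀ h0).mul (hu.mul hv1)).sub (hr.mul (hv.mul hu1))
  simp only [add_zero, mul_one] at key
  refine key.congr' ?_
  have hU : ∀ᶠ p : ℕ × ℂ in atTop ×ˢ 𝓝 z₀, p.2 ∈ regularSet ω :=
    tendsto_snd.eventually ((isOpen_regularSet ω).mem_nhds hz₀)
  filter_upwards [hU] with p hp
  have hp0 := (mem_regularSet_iff.mp hp).1
  simp only [Function.comp, jostApprox, jostPhase_inv hp0]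
  have a1 := jostPhase_ne_zero (c := c) (ω := ω) (γ := γ) (n := p.1) hp0
  have a2 := jostPhase_ne_zero (c := c) (ω := ω) (γ := γ) (n := p.1 + 1) hp0
  field_simp

/-- The orthonormal polynomials grow at most like the inverse of the Jost solution, locally
uniformly on the closed disc. -/
lemma isBigO_jostPoly_mul_jostPhase (hγ : 1 / 3 < γ) (hγ' : γ < 1 / 2)
    (hω : ∀ k : ℤ, 2 * ω ≠ Real.pi * k) (hq : Summable fun n => |q n|)
    (hb : ∀ n : ℕ, 1 ≤ n → b n = c * Real.sin (2 * ω * n + δ) / (n : ℝ) ^ γ + q n)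
    (hz₀ : z₀ ∈ regularSet ω) (hz₁ : ‖z₀‖ ≤ 1) :
    (fun p : ℕ × ℂ => jostPoly b (p.1 + 1) p.2 * jostPhase c ω γ (p.1 + 1) p.2)
      =O[atTop ×ˢ 𝓝[Metric.closedBall 0 1] z₀] (1 : ℕ × ℂ → ℝ) := by
  have hγ0 : 0 < γ := by linarith
  have h0 := (mem_regularSet_iff.mp hz₀).1
  have hz0' := inv_mem_regularSet hz₀
  have hle : atTop ×ˢ 𝓝[Metric.closedBall 0 1] z₀ ≤ (atTop : Filter ℕ) ×ˢ 𝓝 z₀ :=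
    prod_mono_right _ nhdsWithin_le_nhds
  obtain ⟨C₁, hC₁⟩ := (isBigO_jostResidual hγ0 hγ' hω hb hz₀).bound
  obtain ⟨C₂, hC₂⟩ := ((isBigO_jostResidual hγ0 hγ' hω hb hz0').comp_tendsto
    (tendsto_inv_snd h0)).bound
  have hone : ∀ z₁ ∈ regularSet ω, ∀ᶠ p : ℕ × ℂ in atTop ×ˢ 𝓝 z₁,
      ‖1 + jostCorr c ω δ γ p.1 p.2‖ < 2 := fun z₁ h =>
    ((tendsto_jostCorr hγ0 hω h).const_add 1).norm.eventually_lt_const (by simp)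
  have hκ : 0 < ‖z₀⁻¹ - z₀‖ / 2 := by
    have : z₀⁻¹ - z₀ ≠ 0 := fun h => (mem_regularSet_iff.mp hz₀).2.1 (by
      rw [sub_eq_zero] at h
      rw [sq]; nth_rewrite 1 [← h]; exact inv_mul_cancel₀ h0)
    positivity
  have hwr : ∀ᶠ p : ℕ × ℂ in atTop ×ˢ 𝓝 z₀, ‖z₀⁻¹ - z₀‖ / 2 <
      ‖jostApprox c ω δ γ p.1 p.2 * jostApprox c ω δ γ (p.1 + 1) p.2⁻¹ -
        jostApprox c ω δ γ p.1 p.2⁻¹ * jostApprox c ω δ γ (p.1 + 1) p.2‖ :=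
    (tendsto_jostApprox_wronskian hγ0 hγ' hω hz₀).norm.eventually_const_lt (by linarith)
  have hU : ∀ᶠ z in 𝓝 z₀, z ∈ regularSet ω := (isOpen_regularSet ω).mem_nhds hz₀
  obtain ⟨N, hN⟩ := exists_forall_ge_of_eventually_prod
    ((hC₁.filter_mono hle).and ((hC₂.filter_mono hle).and (((hone z₀ hz₀).filter_mono hle).and
      ((((tendsto_inv_snd h0).eventually (hone _ hz0')).filter_mono hle).and
        ((hwr.filter_mono hle).and
        (eventually_norm_jostPhase_succ_le (c := c) hγ0 hγ' hz₀ hz₁))))))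
  set C := max (max C₁ C₂) 2
  have hCC₁ : C₁ ≤ C := (le_max_left _ _).trans (le_max_left _ _)
  have hCC₂ : C₂ ≤ C := (le_max_right _ _).trans (le_max_left _ _)
  have hC2 : 2 ≤ C := le_max_right _ _
  -- The initial quantity of the Gronwall bound at index `N`; its continuity in `z` makes the final
  -- bound locally uniform.
  set G : ℂ → ℝ := fun z =>
    ‖jostPoly b (N + 1) z * jostApprox c ω δ γ N z -
      jostPoly b N z * jostApprox c ω δ γ (N + 1) z‖ +
    ‖jostPoly b (N + 1) z * jostApprox c ω δ γ N z⁻¹ -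
      jostPoly b N z * jostApprox c ω δ γ (N + 1) z⁻¹‖ * ‖jostPhase c ω γ N z‖ ^ 2 with hG
  have hGc : ContinuousAt G z₀ := by
    have c1 := fun n => (analyticAt_jostPoly b n h0).continuousAt
    have c2 := fun n => (analyticAt_jostApprox (c := c) (δ := δ) (γ := γ) (n := n)
      hω hz₀).continuousAt
    have c3 := fun n => ContinuousAt.comp (f := fun z : ℂ => z⁻¹)
      (analyticAt_jostApprox (c := c) (δ := δ) (γ := γ) (n := n) hω hz0').continuousAt
      (continuousAt_inv₀ h0)
    have c4 := (analyticAt_jostPhase (c := c) (γ := γ) (n := N) hz₀).continuousAt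
    exact (((c1 _).mul (c2 _)).sub ((c1 _).mul (c2 _))).norm.add
      ((((c1 _).mul (c3 _)).sub ((c1 _).mul (c3 _))).norm.mul (c4.norm.pow 2))
  have hGb : ∀ᶠ z in 𝓝 z₀, G z < G z₀ + 1 :=
    hGc.tendsto.eventually_lt_const (by linarith)
  refine IsBigO.of_bound (C / (‖z₀⁻¹ - z₀‖ / 2) * ((G z₀ + 1) *
    Real.exp (2 * C ^ 2 / (‖z₀⁻¹ - z₀‖ / 2) * ∑' k, |errorBound γ q k|))) ?_
  filter_upwards [tendsto_fst.eventually (eventually_ge_atTop N),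
    tendsto_snd.eventually hN, hle (tendsto_snd.eventually hU),
    hle (tendsto_snd.eventually hGb)] with p hn hp hpU hpG
  obtain ⟨n, z⟩ := p
  dsimp only at *
  have hz := (mem_regularSet_iff.mp hpU).1
  have hθ : ∀ n, 0 < ‖jostPhase c ω γ n z‖ := fun n => norm_pos_iff.mpr (jostPhase_ne_zero hz)
  have main := solution_bound_of_approx (P := fun n => jostPoly b n z)
    (ψ := fun n => jostApprox c ω δ γ n z) (φ := fun n => jostApprox c ω δ γ n z⁻¹)
    (lam := fun n => z + z⁻¹ - b (n + 1)) (θ := fun n => ‖jostPhase c ω γ n z‖)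
    (ρ := errorBound γ q) (C := C) (κ := ‖z₀⁻¹ - z₀‖ / 2) (N := N) (by linarith) hκ hθ
    (summable_errorBound hγ hq).abs (fun n => jostPoly_add_two b n z)
    (fun n hn => by
      have h := (hp n hn).1
      rw [norm_div, div_le_iff₀ (hθ _), Real.norm_eq_abs] at h
      exact h.trans (by gcongr))
    (fun n hn => by
      have h := (hp n hn).2.1
      simp only [Function.comp] at h
      rw [norm_div, div_le_iff₀ (by rw [jostPhase_inv hz, norm_inv]; exact inv_pos.mpr (hθ _)),
        Real.norm_eq_abs, jostPhase_inv hz, norm_inv, jostResidual, inv_inv,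
        add_comm z⁻¹ z] at h
      exact h.trans (by gcongr))
    (fun n hn => by
      have h := (hp n hn).2.2.1
      rw [jostApprox, norm_mul, mul_comm]
      gcongr
      exact h.le.trans hC2)
    (fun n hn => by
      have h := (hp n hn).2.2.2.1
      rw [jostApprox, norm_mul, mul_comm, jostPhase_inv hz, norm_inv]
      gcongr
      exact h.le.trans hC2)
    (fun n hn => (hp n hn).2.2.2.2.2) (fun n hn => (hp n hn).2.2.2.2.1.le) n hn
  rw [norm_mul]
  simp only [Pi.one_apply, norm_one, mul_one]
  refine main.trans ?_
  gcongr

end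

/-! ### The Jost function and the asymptotics in the disc and on the circle. -/

/-- The discrete Wronskian of the orthonormal polynomials and the approximate Jost solution. -/
noncomputable def jostWronskian (c ω δ γ : ℝ) (b : ℕ → ℝ) (n : ℕ) (z : ℂ) : ℂ :=
  jostPoly b (n + 1) z * jostApprox c ω δ γ n z - jostPoly b n z * jostApprox c ω δ γ (n + 1) z

/-- The Jost function, the limit of the Wronskians. -/
noncomputable def jostFunction (c ω δ γ : ℝ) (b : ℕ → ℝ) (z : ℂ) : ℂ :=
  jostWronskian c ω δ γ b 0 z +
    ∑' n, (jostWronskian c ω δ γ b (n + 1) z - jostWronskian c ω δ γ b n z)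

lemma tendsto_zero_of_contraction {d : ℕ → ℂ} {a : ℂ} (ha : ‖a‖ < 1)
    (h : Tendsto (fun n => d (n + 1) - a * d n) atTop (𝓝 0)) : Tendsto d atTop (𝓝 0) := by
  rw [Metric.tendsto_atTop]
  intro ε hε
  -- Chosen so that `ε/2` is fixed by `x ↦ (1 - |a|)ε/2 + |a|x`, which makes the induction close.
  have hε2 : 0 < (1 - ‖a‖) * (ε / 2) := mul_pos (by linarith) (by linarith)
  obtain ⟨N, hN⟩ := Metric.tendsto_atTop.mp h _ hε2
  have hind : ∀ m, ‖d (N + m)‖ ≤ ε / 2 + ‖a‖ ^ m * ‖d N‖ := by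
    intro m
    induction m with
    | zero => simp; linarith
    | succ m ih =>
      have h1 := hN (N + m) (by omega)
      rw [dist_zero_right] at h1
      have h2 : d (N + (m + 1)) = (d (N + m + 1) - a * d (N + m)) + a * d (N + m) := by
        rw [sub_add_cancel]; rfl
      rw [h2]
      refine (norm_add_le _ _).trans ?_
      rw [norm_mul, pow_succ]
      nlinarith [mul_le_mul_of_nonneg_left ih (norm_nonneg a)]
  have hlim : Tendsto (fun m => ‖a‖ ^ m * ‖d N‖) atTop (𝓝 0) := by
    simpa using (tendsto_pow_atTop_nhds_zero_of_lt_one (norm_nonneg a) ha).mul_const ‖d N‖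
  obtain ⟨M, hM⟩ := eventually_atTop.mp (hlim.eventually_lt_const (half_pos hε))
  refine ⟨N + M, fun n hn => ?_⟩
  obtain ⟨m, rfl⟩ := Nat.exists_eq_add_of_le (show N ≤ n by omega)
  rw [dist_zero_right]
  linarith [hind m, hM m (by omega)]

lemma bounded_of_succ {f : ℕ → ℂ} (h : (fun n => f (n + 1)) =O[atTop] (fun _ => (1 : ℝ))) :
    f =O[atTop] (fun _ => (1 : ℝ)) := by
  obtain ⟨C, hC⟩ := h.bound
  refine IsBigO.of_bound C ?_
  rw [← map_add_atTop_eq_nat 1]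
  exact eventually_map.mpr hC

/-- On the circle `z + 1/z` is real, and the polynomials have real coefficients. -/
lemma conj_jostPoly {z : ℂ} (hz : ‖z‖ = 1) (b : ℕ → ℝ) (n : ℕ) :
    (starRingEnd ℂ) (jostPoly b n z) = jostPoly b n z := by
  rw [jostPoly, orthoPolyEval, ← Polynomial.aeval_conj]
  simp only [map_add, map_div₀, map_one]
  rw [← Complex.inv_eq_conj hz, one_div, one_div, inv_inv, add_comm]

section

variable {c ω δ γ : ℝ} {q b : ℕ → ℝ} {z₀ z : ℂ}

/-- The polynomials solve the recurrence exactly, so only the defect of the approximate solution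
enters. -/
lemma jostWronskian_succ_sub (n : ℕ) :
    jostWronskian c ω δ γ b (n + 1) z - jostWronskian c ω δ γ b n z =
      -(jostPoly b (n + 1) z * jostResidual c ω δ γ b n z) := by
  rw [jostWronskian, jostWronskian, jostPoly_add_two, jostResidual]
  ring

lemma isBigO_jostWronskian_succ_sub (hγ : 1 / 3 < γ) (hγ' : γ < 1 / 2)
    (hω : ∀ k : ℤ, 2 * ω ≠ Real.pi * k) (hq : Summable fun n => |q n|)
    (hb : ∀ n : ℕ, 1 ≤ n → b n = c * Real.sin (2 * ω * n + δ) / (n : ℝ) ^ γ + q n)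
    (hz₀ : z₀ ∈ regularSet ω) (hz₁ : ‖z₀‖ ≤ 1) :
    (fun p : ℕ × ℂ => jostWronskian c ω δ γ b (p.1 + 1) p.2 - jostWronskian c ω δ γ b p.1 p.2)
      =O[atTop ×ˢ 𝓝[Metric.closedBall 0 1] z₀] fun p => errorBound γ q p.1 := by
  have hle : atTop ×ˢ 𝓝[Metric.closedBall 0 1] z₀ ≤ (atTop : Filter ℕ) ×ˢ 𝓝 z₀ :=
    prod_mono_right _ nhdsWithin_le_nhds
  have hU : ∀ᶠ p : ℕ × ℂ in atTop ×ˢ 𝓝 z₀, p.2 ∈ regularSet ω :=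
    tendsto_snd.eventually ((isOpen_regularSet ω).mem_nhds hz₀)
  refine (small_mul_bounded
    ((isBigO_jostResidual (by linarith) hγ' hω hb hz₀).mono hle).neg_left
    (isBigO_jostPoly_mul_jostPhase hγ hγ' hω hq hb hz₀ hz₁)).congr' ?_ EventuallyEq.rfl
  filter_upwards [hU.filter_mono hle] with p hp
  rw [jostWronskian_succ_sub]
  have := jostPhase_ne_zero (c := c) (ω := ω) (γ := γ) (n := p.1 + 1) (mem_regularSet_iff.mp hp).1
  field_simp

/-- Weierstrass test for the telescoping series, with a majorant valid near each point from a common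
index `N` on. -/
lemma tendstoLocallyUniformlyOn_jostWronskian (hγ : 1 / 3 < γ) (hγ' : γ < 1 / 2)
    (hω : ∀ k : ℤ, 2 * ω ≠ Real.pi * k) (hq : Summable fun n => |q n|)
    (hb : ∀ n : ℕ, 1 ≤ n → b n = c * Real.sin (2 * ω * n + δ) / (n : ℝ) ^ γ + q n) :
    TendstoLocallyUniformlyOn (jostWronskian c ω δ γ b) (jostFunction c ω δ γ b) atTop
      (Metric.closedBall 0 1 ∩ regularSet ω) := by
  intro u hu z₀ hz₀
  obtain ⟨C, hC⟩ := (isBigO_jostWronskian_succ_sub hγ hγ' hω hq hb hz₀.2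
    (by simpa using hz₀.1)).bound
  obtain ⟨N, hN⟩ := exists_forall_ge_of_eventually_prod hC
  refine ⟨_, nhdsWithin_mono _ Set.inter_subset_left hN, ?_⟩
  have h := tendstoUniformlyOn_tsum_nat_eventually
    (f := fun n z => jostWronskian c ω δ γ b (n + 1) z - jostWronskian c ω δ γ b n z)
    (u := fun n => C * ‖errorBound γ q n‖)
    (s := {z | ∀ n ≥ N, ‖jostWronskian c ω δ γ b (n + 1) z - jostWronskian c ω δ γ b n z‖ ≤
      C * ‖errorBound γ q n‖})
    ((summable_errorBound hγ hq).norm.mul_left C)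
    ((eventually_ge_atTop N).mono fun n hn z hz => hz n hn)
  rw [Metric.tendstoUniformlyOn_iff] at h
  obtain ⟨ε, hε, hεu⟩ := Metric.mem_uniformity_dist.mp hu
  filter_upwards [h ε hε] with n hn z hz
  apply hεu
  have := hn z hz
  rw [Finset.sum_range_sub (fun n => jostWronskian c ω δ γ b n z)] at this
  rw [dist_eq_norm] at this ⊢
  rw [jostFunction]
  convert this using 2
  ring

lemma analyticAt_jostWronskian (hω : ∀ k : ℤ, 2 * ω ≠ Real.pi * k) (n : ℕ)
    (hz : z ∈ regularSet ω) : AnalyticAt ℂ (jostWronskian c ω δ γ b n) z := by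
  have h0 := (mem_regularSet_iff.mp hz).1
  exact ((analyticAt_jostPoly b _ h0).mul (analyticAt_jostApprox hω hz)).sub
    ((analyticAt_jostPoly b _ h0).mul (analyticAt_jostApprox hω hz))

lemma tendsto_prod_const (l : Filter ℂ) (hl : pure z ≤ l) :
    Tendsto (fun n : ℕ => (n, z)) atTop (atTop ×ˢ l) :=
  tendsto_id.prodMk (tendsto_const_pure.mono_right hl)

lemma tendsto_eval {f : ℕ → ℂ → ℂ} {a : ℂ}
    (h : Tendsto (fun p : ℕ × ℂ => f p.1 p.2) (atTop ×ˢ 𝓝 z) (𝓝 a)) :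
    Tendsto (fun n => f n z) atTop (𝓝 a) :=
  h.comp (tendsto_prod_const _ (pure_le_nhds z))

lemma inv_jostPhase (n : ℕ) :
    (jostPhase c ω γ n z)⁻¹ = 1 / z ^ n * Complex.exp (phaseExponent c ω γ z n) := by
  rw [jostPhase, mul_inv, Complex.exp_neg, inv_inv, one_div]

lemma re_phaseExponent (n : ℕ) : (phaseExponent c ω γ z n).re =
    (mu2 c ω z).re * (n : ℝ) ^ (1 - 2 * γ) / (1 - 2 * γ) := by
  have : phaseExponent c ω γ z n =
      mu2 c ω z * (((n : ℝ) ^ (1 - 2 * γ) / (1 - 2 * γ) : ℝ) : ℂ) := by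
    rw [phaseExponent]; push_cast; ring
  rw [this, Complex.re_mul_ofReal, mul_div_assoc]

lemma norm_jostPhase (n : ℕ) : ‖jostPhase c ω γ n z‖ =
    ‖z‖ ^ n * Real.exp (-((mu2 c ω z).re * (n : ℝ) ^ (1 - 2 * γ) / (1 - 2 * γ))) := by
  rw [jostPhase, norm_mul, norm_pow, Complex.norm_exp, Complex.neg_re, re_phaseExponent]

lemma norm_jostPhase_of_norm_eq_one (hz : ‖z‖ = 1) (n : ℕ) : ‖jostPhase c ω γ n z‖ = 1 := by
  rw [norm_jostPhase, re_mu2_of_norm_eq_one hz, hz]; simp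

lemma tendsto_mul_zero_of_bounded {f g : ℕ → ℂ} (hf : f =O[atTop] (fun _ => (1 : ℝ)))
    (hg : Tendsto g atTop (𝓝 0)) : Tendsto (fun n => f n * g n) atTop (𝓝 0) := by
  rw [← isLittleO_one_iff ℝ] at hg ⊢
  simpa using hf.mul_isLittleO hg

/-- Pointwise convergence of the normalized polynomials inside the disc. -/
lemma tendsto_jostPoly_mul_jostPhase (hγ : 1 / 3 < γ) (hγ' : γ < 1 / 2)
    (hω : ∀ k : ℤ, 2 * ω ≠ Real.pi * k) (hq : Summable fun n => |q n|)
    (hb : ∀ n : ℕ, 1 ≤ n → b n = c * Real.sin (2 * ω * n + δ) / (n : ℝ) ^ γ + q n)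
    (h0 : z ≠ 0) (hz : ‖z‖ < 1) :
    Tendsto (fun n => jostPoly b n z * jostPhase c ω γ n z) atTop
      (𝓝 (z * jostFunction c ω δ γ b z / (1 - z ^ 2))) := by
  have hγ0 : 0 < γ := by linarith
  have hzU := mem_regularSet_of_norm_lt_one (ω := ω) h0 hz
  have hzB : z ∈ Metric.closedBall (0 : ℂ) 1 := by simpa using hz.le
  set p : ℕ → ℂ := fun n => jostPoly b n z * jostPhase c ω γ n z with hp
  have hp1 : (fun n => p (n + 1)) =O[atTop] (fun _ => (1 : ℝ)) :=
    (isBigO_jostPoly_mul_jostPhase hγ hγ' hω hq hb hzU hz.le).comp_tendsto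
      (tendsto_prod_const _ (pure_le_nhdsWithin hzB))
  have hp0 : p =O[atTop] (fun _ => (1 : ℝ)) := bounded_of_succ hp1
  have hW := (tendstoLocallyUniformlyOn_jostWronskian (δ := δ) hγ hγ' hω hq hb).tendsto_at
    ⟨hzB, hzU⟩
  have hu : Tendsto (fun n => jostCorr c ω δ γ n z) atTop (𝓝 0) :=
    tendsto_eval (tendsto_jostCorr hγ0 hω hzU)
  have hu1 := hu.comp (tendsto_add_atTop_nat 1)
  have hr : Tendsto (fun n => jostPhase c ω γ (n + 1) z / jostPhase c ω γ n z) atTop (𝓝 z) :=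
    tendsto_eval (f := fun n z => jostPhase c ω γ (n + 1) z / jostPhase c ω γ n z)
      (tendsto_jostPhase_div hγ0 hγ' hzU)
  have t1 : Tendsto (fun n => z * (jostWronskian c ω δ γ b n z - jostFunction c ω δ γ b z))
      atTop (𝓝 0) := by
    simpa using (hW.sub_const (jostFunction c ω δ γ b z)).const_mul z
  have t2 := tendsto_mul_zero_of_bounded hp1 (g := fun n => 1 -
      z * (jostPhase c ω γ (n + 1) z / jostPhase c ω γ n z)⁻¹ * (1 + jostCorr c ω δ γ n z)) (by
    simpa [h0] using (((hr.inv₀ h0).const_mul z).mul (hu.const_add 1)).const_sub 1)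
  have t3 := tendsto_mul_zero_of_bounded hp0 (g := fun n =>
      z * (jostPhase c ω γ (n + 1) z / jostPhase c ω γ n z) *
        (1 + jostCorr c ω δ γ (n + 1) z) - z * z) (by
    simpa using ((hr.const_mul z).mul (hu1.const_add 1)).sub_const (z * z))
  have hz2 : 1 - z ^ 2 ≠ 0 := sub_ne_zero.mpr (mem_regularSet_iff.mp hzU).2.1.symm
  -- The convergence of the Wronskians reads `p (n + 1) - z² p n → zF`, whose fixed point is the
  -- subtracted constant; `t1`, `t2`, `t3` add up to the defect.
  have key : Tendsto (fun n => p n - z * jostFunction c ω δ γ b z / (1 - z ^ 2)) atTop (𝓝 0) := by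
    refine tendsto_zero_of_contraction (a := z ^ 2)
      (by rw [norm_pow]; exact pow_lt_one₀ (norm_nonneg _) hz two_ne_zero) ?_
    have t := (t1.add t2).add t3
    simp only [add_zero] at t
    refine t.congr fun n => ?_
    have a1 := jostPhase_ne_zero (c := c) (ω := ω) (γ := γ) (n := n) h0
    have a2 := jostPhase_ne_zero (c := c) (ω := ω) (γ := γ) (n := n + 1) h0
    simp only [hp, jostWronskian, jostApprox]
    field_simp
    ring
  exact tendsto_sub_nhds_zero_iff.mp key

/-- The asymptotics of the polynomials on the unit circle. -/
lemma tendsto_jostPoly_sub_of_norm_eq_one (hγ : 1 / 3 < γ) (hγ' : γ < 1 / 2)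
    (hω : ∀ k : ℤ, 2 * ω ≠ Real.pi * k) (hq : Summable fun n => |q n|)
    (hb : ∀ n : ℕ, 1 ≤ n → b n = c * Real.sin (2 * ω * n + δ) / (n : ℝ) ^ γ + q n)
    (hz : ‖z‖ = 1) (hzU : z ∈ regularSet ω) :
    Tendsto (fun n => jostPoly b n z -
      (z * jostFunction c ω δ γ b z / (1 - z ^ 2) * (jostPhase c ω γ n z)⁻¹ +
        z * (starRingEnd ℂ) (jostFunction c ω δ γ b z) / (z ^ 2 - 1) * jostPhase c ω γ n z))
      atTop (𝓝 0) := by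
  have hγ0 : 0 < γ := by linarith
  have h0 := (mem_regularSet_iff.mp hzU).1
  have hzB : z ∈ Metric.closedBall (0 : ℂ) 1 := by simpa using hz.le
  have hθ := norm_jostPhase_of_norm_eq_one (c := c) (ω := ω) (γ := γ) hz
  have hθ1 : (fun n => (jostPhase c ω γ n z)⁻¹) =O[atTop] (fun _ => (1 : ℝ)) :=
    IsBigO.of_bound 1 (Eventually.of_forall fun n => by simp [hθ])
  have hp1 : (fun n => jostPoly b (n + 1) z) =O[atTop] (fun _ => (1 : ℝ)) := by
    refine (((isBigO_jostPoly_mul_jostPhase hγ hγ' hω hq hb hzU hz.le).comp_tendsto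
      (tendsto_prod_const _ (pure_le_nhdsWithin hzB))).norm_left.congr_left fun n => ?_).of_norm_left
    simp [hθ]
  have hp0 : (fun n => jostPoly b n z) =O[atTop] (fun _ => (1 : ℝ)) := bounded_of_succ hp1
  have hW := (tendstoLocallyUniformlyOn_jostWronskian (δ := δ) hγ hγ' hω hq hb).tendsto_at
    ⟨hzB, hzU⟩
  have hu : Tendsto (fun n => jostCorr c ω δ γ n z) atTop (𝓝 0) :=
    tendsto_eval (tendsto_jostCorr hγ0 hω hzU)
  have hu1 := hu.comp (tendsto_add_atTop_nat 1)
  have hr : Tendsto (fun n => jostPhase c ω γ (n + 1) z / jostPhase c ω γ n z) atTop (𝓝 z) :=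
    tendsto_eval (f := fun n z => jostPhase c ω γ (n + 1) z / jostPhase c ω γ n z)
      (tendsto_jostPhase_div hγ0 hγ' hzU)
  have t1 := tendsto_mul_zero_of_bounded hθ1 (g := fun n =>
    jostWronskian c ω δ γ b n z - jostFunction c ω δ γ b z)
    (by simpa using hW.sub_const (jostFunction c ω δ γ b z))
  have t2 := tendsto_mul_zero_of_bounded hp1 hu
  have t3 := tendsto_mul_zero_of_bounded hp0 (g := fun n =>
      jostPhase c ω γ (n + 1) z / jostPhase c ω γ n z * (1 + jostCorr c ω δ γ (n + 1) z) - z) (by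
    simpa using (hr.mul (hu1.const_add 1)).sub_const z)
  -- On the circle the phase has modulus one, so the Wronskian limit may be divided by it without
  -- loss.
  have key : Tendsto (fun n => jostPoly b (n + 1) z - z * jostPoly b n z -
      jostFunction c ω δ γ b z * (jostPhase c ω γ n z)⁻¹) atTop (𝓝 0) := by
    have t := (t1.sub t2).add t3
    simp only [add_zero, sub_zero] at t
    refine t.congr fun n => ?_
    have a1 := jostPhase_ne_zero (c := c) (ω := ω) (γ := γ) (n := n) h0
    simp only [jostWronskian, jostApprox]
    field_simp
    ring
  -- Conjugation fixes the polynomials and inverts `z` and the phase; subtracting the two relations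
  -- eliminates `P_{n+1}` and leaves `(1/z - z) P_n`.
  have keyc := (Complex.continuous_conj.tendsto 0).comp key
  have hcz : (starRingEnd ℂ) z = z⁻¹ := (Complex.inv_eq_conj hz).symm
  have hcθ : ∀ n, (starRingEnd ℂ) (jostPhase c ω γ n z) = (jostPhase c ω γ n z)⁻¹ :=
    fun n => (Complex.inv_eq_conj (hθ n)).symm
  have hz2 : 1 - z ^ 2 ≠ 0 := sub_ne_zero.mpr (mem_regularSet_iff.mp hzU).2.1.symm
  have hz3 : z ^ 2 - 1 = -(1 - z ^ 2) := by ring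
  have fin := (key.sub keyc).const_mul (-(z / (1 - z ^ 2)))
  simp only [map_zero, sub_zero, mul_zero] at fin
  refine (fin.neg.congr fun n => ?_).trans (by simp)
  simp only [Function.comp, map_sub, map_mul, map_inv₀, conj_jostPoly hz, hcz, hcθ, inv_inv, hz3,
    div_neg]
  have a1 := jostPhase_ne_zero (c := c) (ω := ω) (γ := γ) (n := n) h0
  field_simp
  ring

end

/-! ### Assembly of the theorem. -/

theorem theorem5p1 (c ω δ γ : ℝ) (q b : ℕ → ℝ)
    (hγ : γ ∈ Set.Ioo (1 / 3 : ℝ) (1 / 2))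
    (hω : ∀ k : ℤ, 2 * ω ≠ Real.pi * k)
    (hq : Summable fun n : ℕ => |q n|)
    (hb : ∀ n : ℕ, 1 ≤ n → b n = c * Real.sin (2 * ω * n + δ) / (n : ℝ) ^ γ + q n) :
    ∃ F : ℂ → ℂ,
      (∀ z ∈ Metric.ball (0 : ℂ) 1 \ {0},
        (fun n : ℕ => orthoPolyEval b n (z + 1 / z) -
            z * F z / (1 - z ^ 2) * (1 / z ^ n) * Complex.exp (phaseExponent c ω γ z n))
          =o[atTop] fun n : ℕ =>
            1 / ‖z‖ ^ n * Real.exp ((mu2 c ω z).re * (n : ℝ) ^ (1 - 2 * γ) / (1 - 2 * γ))) ∧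
      (∀ z ∈ Metric.sphere (0 : ℂ) 1 ∩ regularSet ω,
        (fun n : ℕ => orthoPolyEval b n (z + 1 / z) -
            (z * F z / (1 - z ^ 2) * (1 / z ^ n) * Complex.exp (phaseExponent c ω γ z n) +
              z * (starRingEnd ℂ) (F z) / (z ^ 2 - 1) * z ^ n *
                Complex.exp (-phaseExponent c ω γ z n)))
          =o[atTop] fun _ : ℕ => (1 : ℝ)) ∧
      AnalyticOnNhd ℂ F (Metric.ball (0 : ℂ) 1 \ {0}) ∧
      ContinuousOn F (Metric.closedBall (0 : ℂ) 1 ∩ regularSet ω) := by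
  obtain ⟨hγ1, hγ2⟩ := hγ
  have hlim := tendstoLocallyUniformlyOn_jostWronskian (δ := δ) hγ1 hγ2 hω hq hb
  have hsub : Metric.ball (0 : ℂ) 1 \ {0} ⊆ Metric.closedBall 0 1 ∩ regularSet ω := fun z hz =>
    ⟨Metric.ball_subset_closedBall hz.1,
      mem_regularSet_of_norm_lt_one hz.2 (by simpa using hz.1)⟩
  have hopen : IsOpen (Metric.ball (0 : ℂ) 1 \ {0}) := Metric.isOpen_ball.sdiff isClosed_singleton
  refine ⟨jostFunction c ω δ γ b, fun z hz => ?_, fun z hz => ?_, ?_, ?_⟩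
  · have h0 : z ≠ 0 := hz.2
    have h := (tendsto_jostPoly_mul_jostPhase hγ1 hγ2 hω hq hb h0 (by simpa using hz.1)).sub_const
      (z * jostFunction c ω δ γ b z / (1 - z ^ 2))
    rw [sub_self, ← isLittleO_one_iff ℝ] at h
    have h2 := (isBigO_refl (fun n => (jostPhase c ω γ n z)⁻¹) atTop).norm_right.mul_isLittleO h
    refine (h2.congr_left fun n => ?_).congr_right fun n => ?_
    · have := jostPhase_ne_zero (c := c) (ω := ω) (γ := γ) (n := n) h0
      rw [mul_assoc, ← inv_jostPhase]
      change _ = jostPoly b n z - _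
      field_simp
    · rw [mul_one, norm_inv, norm_jostPhase, mul_inv, Real.exp_neg, inv_inv, one_div]
  · rw [isLittleO_one_iff]
    refine (tendsto_jostPoly_sub_of_norm_eq_one hγ1 hγ2 hω hq hb (by simpa using hz.1)
      hz.2).congr fun n => ?_
    rw [inv_jostPhase, jostPhase, jostPoly]
    ring
  · refine DifferentiableOn.analyticOnNhd ?_ hopen
    exact (hlim.mono hsub).differentiableOn (Eventually.of_forall fun n z hz =>
      (analyticAt_jostWronskian hω n (hsub hz).2).differentiableAt.differentiableWithinAt) hopen
  · exact hlim.continuousOn (Frequently.of_forall fun n z hz =>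
      (analyticAt_jostWronskian hω n hz.2).continuousAt.continuousWithinAt)
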